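/- Throughout, $[a,b]=a^{-1}b^{-1}ab$. For letters $x_1,\dots,x_r$, formal commutators are the letters and, recursively, the brackets $[\alpha,\alpha']$ of formal commutators $\alpha,\alpha'$. The weight vector $\chi(\alpha)\in\mathbb{Z}_{\ge0}^r$ counts the occurrences of each letter in $\alpha$, and the total weight $|\chi(\alpha)|$ is the sum of its entries. A complete ordered list of basic commutators $u_1,u_2,\dots$ is defined recursively. Put $u_i=x_i$ for $1\le i\le r$. For $k\ge2$, once all basic commutators of total weight less than $k$ have been listed, the basic commutators of total weight $k$ are the formal commutators of total weight $k$ of the form $[u_i,u_j]$ with $i>j$ and such that $j\ge t$ whenever $u_i=[u_q,u_t]$; they are appended to the list, each once, in any order in which those with the same weight vector are consecutive. Elements $x_1,\dots,x_r$ of a group freely generate a free $s$-step nilpotent group if the kernel of the natural homomorphism from the free group $F$ of rank $r$ to that group is the $(s+1)$-st term $\gamma_{s+1}(F)$ of the lower central series of $F$ (where $\gamma_1(F)=F$). A free nilpotent progression of rank $r$ and step $s$ with side lengths $L_1,\dots,L_r$ (positive integers) is a set $$P=\{u_1^{\ell_1}u_2^{\ell_2}\cdots u_d^{\ell_d}:\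 \ell_i\in\mathbb{Z},\ |\ell_i|\le L^{\chi(u_i)}\},\qquad L^{\chi}:=L_1^{\chi_1}\cdots L_r^{\chi_r},$$ where $x_1,\dots,x_r$ are elements of a group freely generating a free $s$-step nilpotent group and $u_1,\dots,u_d$ is a complete ordered list of the basic commutators of total weight at most $s$, interpreted in that group. **Statement.** For all $r,s\in\mathbb{N}$ there exists a constant $M=M_{r,s}$ such that for every $c>0$ there exists a constant $K=K_{c,r,s}$ with the following property. Let $P$ be a free nilpotent progression of rank $r$ and step $s$ with side lengths $L_1,\dots,L_r\ge M$, and let $A\subset P$ be symmetric ($A^{-1}=A$) with $\langle A\rangle=\langle P\rangle$ and $|A|\ge c|P|$. Then every element of $P$ is a product of at most $K$ elements of $A$, that is, $P\subset\bigcup_{0\le k\le K}A^k$. (If $1\in A$, this says $P\subset A^K$.) -/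

import Mathlib

open scoped Pointwise

/-- Formal commutators in the letters `x_0, …, x_{r-1}`. Only those formal commutators that are
built from the letters themselves are included: formal inverses of letters never occur in a
basic commutator. -/
inductive FormalCommutator (r : ℕ) : Type
  | letter (i : Fin r) : FormalCommutator r
  | bracket (α β : FormalCommutator r) : FormalCommutator r

namespace FormalCommutator

/-- The weight vector `χ(α)`: `χ_j(α)` is the number of occurrences of the letter `x_j`. -/
def weight {r : ℕ} : FormalCommutator r → (Fin r → ℕ)
  | letter i => Pi.single i 1
  | bracket α β => α.weight + β.weight

/-- The total weight `|χ(α)| = ∑ j, χ_j(α)`. -/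
def totalWeight {r : ℕ} (α : FormalCommutator r) : ℕ := ∑ j, α.weight j

/-- The interpretation of a formal commutator in a group, with the convention
`[a, b] = a⁻¹ b⁻¹ a b`. -/
def eval {G : Type*} [Group G] {r : ℕ} (x : Fin r → G) : FormalCommutator r → G
  | letter i => x i
  | bracket α β => (α.eval x)⁻¹ * (β.eval x)⁻¹ * α.eval x * β.eval x

/-- `L^χ(α) = ∏ j, L_j ^ χ_j(α)`. -/
def length {r : ℕ} (L : Fin r → ℕ) (α : FormalCommutator r) : ℕ := ∏ j, L j ^ α.weight j

end FormalCommutator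

open FormalCommutator in
/-- If `l = [u_0, u_1, …]` is the list of basic commutators of smaller total weight, this is the
condition for `α` to be a basic commutator: `α = [u_i, u_j]` for some `i > j`, where moreover
`j ≥ t` in case `u_i = [u_k, u_t]`. -/
def IsBasicOver {r : ℕ} (l : List (FormalCommutator r)) (α : FormalCommutator r) : Prop :=
  ∃ i j : Fin l.length, j < i ∧ α = bracket (l.get i) (l.get j) ∧
    ∀ k t : Fin l.length, l.get i = bracket (l.get k) (l.get t) → t ≤ j

/-- `IsBasicList r s l`: `l` is a complete ordered list of the basic commutators of total weight
at most `s` in `r` letters. The list starts with the letters in their order; the basic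
commutators of total weight `k + 1` are listed after those of total weight at most `k`, in an
arbitrary order such that those with the same weight vector are consecutive. -/
inductive IsBasicList (r : ℕ) : ℕ → List (FormalCommutator r) → Prop
  | zero : IsBasicList r 0 []
  | one : IsBasicList r 1 (List.ofFn FormalCommutator.letter)
  | step {k : ℕ} {l l' : List (FormalCommutator r)} (hk : 1 ≤ k) (hl : IsBasicList r k l)
      (nodup : l'.Nodup)
      (mem_iff : ∀ α, α ∈ l' ↔ α.totalWeight = k + 1 ∧ IsBasicOver l α)
      (consecutive : ∀ a b c : Fin l'.length, a ≤ b → b ≤ c →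
        (l'.get a).weight = (l'.get c).weight → (l'.get b).weight = (l'.get a).weight) :
      IsBasicList r (k + 1) (l ++ l')

/-- The ordered progression `{u_1^{ℓ_1} ⋯ u_d^{ℓ_d} : |ℓ_i| ≤ L_i}`. -/
def orderedProgression {G : Type*} [Group G] {d : ℕ} (u : Fin d → G) (L : Fin d → ℕ) : Set G :=
  {g | ∃ e : Fin d → ℤ, (∀ i, |e i| ≤ (L i : ℤ)) ∧ g = (List.ofFn fun i => u i ^ e i).prod}

/-- The nilpotent progression on generators `x` with lengths `L`, with respect to the complete
ordered list `l` of basic commutators: the ordered progression on the interpretations of the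
entries `u` of `l`, with lengths `L^χ(u)` (which is `L i` for the letter `x i`). -/
def nilpotentProgression {G : Type*} [Group G] {r : ℕ} (x : Fin r → G) (L : Fin r → ℕ)
    (l : List (FormalCommutator r)) : Set G :=
  orderedProgression (fun i : Fin l.length => (l.get i).eval x)
    (fun i : Fin l.length => (l.get i).length L)

/-- The elements `x i` freely generate a free `s`-step nilpotent group: the natural map from the
free group `F` of rank `r` onto the subgroup they generate has kernel the `(s+1)`-st term of the
lower central series of `F` (which Mathlib numbers from `0`). -/
def FreelyGeneratesNilpotent {G : Type*} [Group G] {r : ℕ} (s : ℕ) (x : Fin r → G) : Prop :=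
  (FreeGroup.lift x).ker = (⊤ : Subgroup (FreeGroup (Fin r))).lowerCentralSeries s

/-- `P` is a free nilpotent progression of rank `r` and step `s` with side lengths `L`. -/
def IsFreeNilpotentProgression {G : Type*} [Group G] (r s : ℕ) (L : Fin r → ℕ)
    (P : Set G) : Prop :=
  (∀ i, 0 < L i) ∧ ∃ (x : Fin r → G) (l : List (FormalCommutator r)),
    FreelyGeneratesNilpotent s x ∧ IsBasicList r s l ∧ P = nilpotentProgression x L l

/-!
Adjoining `1` to `A` only replaces powers of `A` by unions of powers, so let `1 ∈ A`. The argument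
takes place in the free nilpotent group `Γ = F / γ_{s+1}(F)`, which embeds into every group
containing a free nilpotent progression, and it needs no lower bound on the side lengths beyond
their positivity.

*Abelianization.* The progression is `P = {x₁^{t₁} ⋯ x_r^{t_r} q : |t_j| ≤ L_j, q ∈ Q}` with
`Q ⊆ [Γ, Γ]`, so all its fibres over the box `{|t_j| ≤ L_j}` in `ℤʳ` have size `|Q|`, and the image
of `A` in `ℤʳ` has density at least `c` in this box (`ncard_box_le_ncard_image`). A dense symmetric
generating subset of a box fills it in boundedly many steps (`exists_box_subset_pow`): long
directions are handled by pigeonhole, and modulo those only finitely many configurations remain.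
Hence bounded powers of `A` contain every `x_j ^ p`, `|p| ≤ L_j`, up to a factor in `[Γ, Γ]`.

*Ascent along the lower central series.* Modulo higher weight, the commutator of `α ^ p` and
`β ^ q` is `[α, β] ^ (p q)`, and every `0 ≤ n ≤ L ^ χ([α, β])` is a sum of two products `p q` with
`p ≤ L ^ χ(α)`, `q ≤ L ^ χ(β)`. So by induction bounded powers of `A` contain all `α ^ p`,
`|p| ≤ L ^ χ(α)`, up to factors of higher weight, and by descending induction on the weight, which
is at most `s`, also exactly (`boundedFamilies_le`). For this the factors of higher weight must be
products of boundedly many `γ ^ m` with `|m| ≤ C L ^ χ(γ)`. No independence of basic commutators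
is used.

*Uniformity.* To avoid tracking constants, elements of `Γ` are replaced by families `ι → Γ`, and
boundedness by membership in the subgroup `boundedFamilies`. A denominator `N` in this subgroup
records how much smaller than `L ^ χ(α)` the exponents are. The commutator estimate `CommBound` and
the estimate `ProdBound` for products of long sequences of small factors are proved together, by
descending induction on the weight (`commBound_and_prodBound`): `[α ^ p, β ^ q]` is a product of
`p` conjugates of `[α, β ^ q]`, itself the inverse of a product of `q` conjugates of `[β, α]`, and a
product of many factors is collected by pulling out one power at a time. At the end, a sequence of
counterexamples with ever larger constants is a family contradicting this calculus.
-/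

/-! ### Commutators of bounded families -/

namespace NilpotentProgression

variable {Γ : Type*} [Group Γ] {r : ℕ} {ι : Type}

/-- The group commutator in the convention `[a, b] = a⁻¹ b⁻¹ a b`. -/
def comm (a b : Γ) : Γ := a⁻¹ * b⁻¹ * a * b

lemma length_pos {L : Fin r → ℕ} (hL : ∀ j, 1 ≤ L j) (α : FormalCommutator r) :
    1 ≤ α.length L :=
  Nat.succ_le_of_lt (Finset.prod_pos fun j _ => pow_pos (hL j) _)

lemma length_bracket (L : Fin r → ℕ) (α β : FormalCommutator r) :
    (α.bracket β).length L = α.length L * β.length L := by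
  simp [FormalCommutator.length, FormalCommutator.weight, pow_add, Finset.prod_mul_distrib]

lemma totalWeight_bracket (α β : FormalCommutator r) :
    (α.bracket β).totalWeight = α.totalWeight + β.totalWeight := by
  simp [FormalCommutator.totalWeight, FormalCommutator.weight, Finset.sum_add_distrib]

lemma totalWeight_letter (j : Fin r) :
    (FormalCommutator.letter j).totalWeight = 1 := by
  simp [FormalCommutator.totalWeight, FormalCommutator.weight]

lemma length_letter (L : Fin r → ℕ) (j : Fin r) :
    (FormalCommutator.letter j).length L = L j := by
  simp only [FormalCommutator.length, FormalCommutator.weight]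
  rw [Finset.prod_eq_single j] <;> simp +contextual

lemma totalWeight_pos (α : FormalCommutator r) : 1 ≤ α.totalWeight := by
  induction α with
  | letter j => rw [totalWeight_letter]
  | bracket α β hα hβ => rw [totalWeight_bracket]; omega

/-- Families `ι → Γ` that are products of boundedly many families of the form
`i ↦ α ^ p i` with `α` a fixed formal commutator of total weight at least `w` and
`0 ≤ p i ≤ L i ^ χ(α) / N i`. The number of factors being independent of `i`, membership in this
subgroup is a bound that is uniform in `i`. -/
def boundedFamilies (x : Fin r → Γ) (L : ι → Fin r → ℕ) (N : ι → ℕ) (w : ℕ) :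
    Subgroup (ι → Γ) :=
  Subgroup.closure {g | ∃ (α : FormalCommutator r) (p : ι → ℕ), w ≤ α.totalWeight ∧
    (∀ i, N i * p i ≤ α.length (L i)) ∧ g = fun i => α.eval x ^ p i}

variable {x : Fin r → Γ} {L : ι → Fin r → ℕ} {N N' : ι → ℕ} {v w : ℕ}

lemma pow_mem_boundedFamilies {α : FormalCommutator r} {p : ι → ℕ} (hw : w ≤ α.totalWeight)
    (hp : ∀ i, N i * p i ≤ α.length (L i)) :
    (fun i => α.eval x ^ p i) ∈ boundedFamilies x L N w :=
  Subgroup.subset_closure ⟨α, p, hw, hp, rfl⟩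

lemma zpow_mem_boundedFamilies {α : FormalCommutator r} {p : ι → ℤ} (hw : w ≤ α.totalWeight)
    (hp : ∀ i, N i * |p i| ≤ α.length (L i)) :
    (fun i => α.eval x ^ p i) ∈ boundedFamilies x L N w := by
  have key : ∀ q : ι → ℤ, (∀ i, N i * |q i| ≤ α.length (L i)) →
      ∀ i, N i * (q i).toNat ≤ α.length (L i) := by
    intro q hq i
    have h1 : ((q i).toNat : ℤ) ≤ |q i| := by rw [Int.toNat_eq_max]; simp [le_abs_self]
    have h2 : (N i : ℤ) * (q i).toNat ≤ N i * |q i| := by gcongr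
    exact_mod_cast h2.trans (hq i)
  have h1 := pow_mem_boundedFamilies (x := x) hw (key p hp)
  have h2 := pow_mem_boundedFamilies (x := x) hw (key (fun i => - p i) (by simpa using hp))
  have := mul_mem h1 (inv_mem h2)
  convert this using 1
  funext i
  simp only [Pi.mul_apply, Pi.inv_apply, ← zpow_natCast, ← zpow_neg, ← zpow_add]
  congr 1
  exact (Int.toNat_sub_toNat_neg (p i)).symm

lemma boundedFamilies_mono (hN : ∀ i, N' i ≤ N i) (hw : w ≤ v) :
    boundedFamilies x L N v ≤ boundedFamilies x L N' w := by
  refine Subgroup.closure_mono ?_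
  rintro _ ⟨α, p, h1, h2, rfl⟩
  exact ⟨α, p, hw.trans h1, fun i => (Nat.mul_le_mul_right _ (hN i)).trans (h2 i), rfl⟩

lemma boundedFamilies_reindex {κ : Type} (f : κ → ι) {g : ι → Γ}
    (hg : g ∈ boundedFamilies x L N w) :
    (fun k => g (f k)) ∈ boundedFamilies x (fun k => L (f k)) (fun k => N (f k)) w := by
  induction hg using Subgroup.closure_induction with
  | mem g hg =>
    obtain ⟨α, p, h1, h2, rfl⟩ := hg
    exact pow_mem_boundedFamilies h1 fun k => h2 (f k)
  | one => exact one_mem _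
  | mul a b _ _ ha hb => exact mul_mem ha hb
  | inv a _ ha => exact inv_mem ha

lemma boundedFamilies_eq_bot {s : ℕ} (hx : ∀ α : FormalCommutator r, s < α.totalWeight →
    α.eval x = 1) (hw : s < w) : boundedFamilies x L N w = ⊥ := by
  rw [boundedFamilies, Subgroup.closure_eq_bot_iff]
  rintro _ ⟨α, p, h1, -, rfl⟩
  simp [hx α (hw.trans_le h1)]
  rfl

/-- Commutators of bounded families are bounded, with weights adding up and denominators
multiplying, as long as the total weight is at least `n`. -/
def CommBound (x : Fin r → Γ) (n : ℕ) : Prop :=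
  ∀ (ι : Type) (L : ι → Fin r → ℕ) (N N' : ι → ℕ) (v w : ℕ), (∀ i j, 1 ≤ L i j) →
    (∀ i, 1 ≤ N i) → (∀ i, 1 ≤ N' i) → 1 ≤ v → 1 ≤ w → n ≤ v + w →
    ∀ g ∈ boundedFamilies x L N v, ∀ h ∈ boundedFamilies x L N' w,
      comm g h ∈ boundedFamilies x L (N * N') (v + w)

/-- A product of `m i` factors that are bounded with denominator `N i`, uniformly in `i` and in
the number of the factor, is bounded with denominator `N i / m i`, as long as the weight is at
least `n`. The product is presented through its partial products `F i k`. -/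
def ProdBound (x : Fin r → Γ) (n : ℕ) : Prop :=
  ∀ (ι : Type) (L : ι → Fin r → ℕ) (N N' m : ι → ℕ) (w : ℕ), (∀ i j, 1 ≤ L i j) →
    (∀ i, 1 ≤ N i) → (∀ i, 1 ≤ N' i) → (∀ i, m i * N' i ≤ N i) → 1 ≤ w → n ≤ w →
    ∀ d ∈ boundedFamilies (ι := ι × ℕ) x (fun i => L i.1) (fun i => N i.1) w,
    ∀ F : ι → ℕ → Γ, (∀ i, F i 0 = 1) → (∀ i, ∀ k < m i, F i (k + 1) = d (i, k) * F i k) →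
      (fun i => F i (m i)) ∈ boundedFamilies x L N' w

lemma CommBound.mono {n n' : ℕ} (h : CommBound x n) (hn : n ≤ n') : CommBound x n' :=
  fun ι L N N' v w hL h1 h2 h3 h4 h5 => h ι L N N' v w hL h1 h2 h3 h4 (hn.trans h5)

lemma ProdBound.mono {n n' : ℕ} (h : ProdBound x n) (hn : n ≤ n') : ProdBound x n' :=
  fun ι L N N' m w hL h1 h2 h3 h4 h5 => h ι L N N' m w hL h1 h2 h3 h4 (hn.trans h5)

lemma CommBound.comm_mem {n u : ℕ} (hC : CommBound x n) {g h : ι → Γ}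
    (hg : g ∈ boundedFamilies x L N v) (hh : h ∈ boundedFamilies x L N' w)
    (hL : ∀ i j, 1 ≤ L i j) (hN : ∀ i, 1 ≤ N i) (hN' : ∀ i, 1 ≤ N' i) (hv : 1 ≤ v) (hw : 1 ≤ w)
    (hn : n ≤ v + w) (hu : u ≤ v + w) : comm g h ∈ boundedFamilies x L N u :=
  boundedFamilies_mono (fun i => Nat.le_mul_of_pos_right _ (hN' i)) hu
    (hC ι L N N' v w hL hN hN' hv hw hn g hg h hh)

lemma CommBound.conj_mem {n : ℕ} (hC : CommBound x n) {g h : ι → Γ}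
    (hg : g ∈ boundedFamilies x L N v) (hh : h ∈ boundedFamilies x L N' w)
    (hL : ∀ i j, 1 ≤ L i j) (hN : ∀ i, 1 ≤ N i) (hN' : ∀ i, 1 ≤ N' i) (hv : 1 ≤ v) (hw : 1 ≤ w)
    (hn : n ≤ v + w) : h⁻¹ * g * h ∈ boundedFamilies x L N v := by
  have h2 : h⁻¹ * g * h = g * comm g h := by simp only [comm]; group
  rw [h2]
  exact mul_mem hg (hC.comm_mem hg hh hL hN hN' hv hw hn (by omega))

/-- One collection step: a power of `γ` is pulled out of each factor of a product, at the price
of conjugating the remaining factors by bounded powers of `γ`. -/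
lemma exists_pull_out (γ : FormalCommutator r) {m : ι → ℕ} (hm : ∀ i, m i * N' i ≤ N i)
    {p : ι × ℕ → ℤ} (hp : ∀ i, N i.1 * |p i| ≤ γ.length (L i.1)) {d : ι × ℕ → Γ} {F : ι → ℕ → Γ}
    (hF0 : ∀ i, F i 0 = 1)
    (hF : ∀ i, ∀ k < m i, F i (k + 1) = γ.eval x ^ p (i, k) * d (i, k) * F i k) :
    ∃ h ∈ boundedFamilies (ι := ι × ℕ) x (fun i => L i.1) (fun i => N' i.1) γ.totalWeight,
    ∃ F' : ι → ℕ → Γ, (∀ i, F' i 0 = 1) ∧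
      (∀ i, ∀ k < m i, F' i (k + 1) = (h⁻¹ * d * h) (i, k) * F' i k) ∧
      (∀ i, N' i * |∑ t ∈ Finset.range (m i), p (i, t)| ≤ γ.length (L i)) ∧
      ∀ i, F i (m i) = γ.eval x ^ (∑ t ∈ Finset.range (m i), p (i, t)) * F' i (m i) := by
  have bound : ∀ i k, k ≤ m i →
      N' i * |∑ t ∈ Finset.range k, p (i, t)| ≤ γ.length (L i) := by
    intro i k hk
    rcases Nat.eq_zero_or_pos (m i) with h0 | h0
    · obtain rfl : k = 0 := by omega
      simp
    have h1 : ∀ t, (m i : ℤ) * (N' i * |p (i, t)|) ≤ γ.length (L i) := by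
      intro t
      refine le_trans ?_ (hp (i, t))
      rw [← mul_assoc]
      gcongr
      exact_mod_cast hm i
    have h2 : (m i : ℤ) * (N' i * |∑ t ∈ Finset.range k, p (i, t)|)
        ≤ ∑ t ∈ Finset.range k, (m i : ℤ) * (N' i * |p (i, t)|) := by
      rw [← Finset.mul_sum, ← Finset.mul_sum]
      gcongr
      exact Finset.abs_sum_le_sum_abs _ _
    have h3 : ∑ t ∈ Finset.range k, (m i : ℤ) * (N' i * |p (i, t)|)
        ≤ k * γ.length (L i) := by
      refine (Finset.sum_le_card_nsmul _ _ _ fun t _ => h1 t).trans (by simp)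
    have h4 : (k : ℤ) * γ.length (L i) ≤ m i * γ.length (L i) := by gcongr
    exact le_of_mul_le_mul_left ((h2.trans h3).trans h4) (by exact_mod_cast h0)
  refine ⟨fun i => γ.eval x ^ ∑ t ∈ Finset.range (min i.2 (m i.1)), p (i.1, t),
    zpow_mem_boundedFamilies le_rfl fun i => bound i.1 _ (min_le_right _ _),
    fun i k => (γ.eval x ^ ∑ t ∈ Finset.range k, p (i, t))⁻¹ * F i k, ?_, ?_, ?_, ?_⟩
  · intro i; simp [hF0]
  · intro i k hk
    simp only [Pi.mul_apply, Pi.inv_apply, min_eq_left hk.le, Finset.sum_range_succ, hF i k hk,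
      zpow_add]
    group
  · exact fun i => bound i _ le_rfl
  · intro i; simp

/-- A product of factors `γ ^ p k * e k`, with `e k` of higher weight, is `γ ^ ∑ p k` up to a
factor of higher weight. -/
lemma ProdBound.main_term {γ : FormalCommutator r} (hP : ProdBound x (γ.totalWeight + 1))
    (hC : CommBound x (γ.totalWeight + 1)) {m : ι → ℕ} (hL : ∀ i j, 1 ≤ L i j)
    (hN : ∀ i, 1 ≤ N i) (hN' : ∀ i, 1 ≤ N' i) (hm : ∀ i, m i * N' i ≤ N i)
    {p : ι × ℕ → ℤ} (hp : ∀ i, N i.1 * |p i| ≤ γ.length (L i.1)) {e : ι × ℕ → Γ}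
    (he : e ∈ boundedFamilies (ι := ι × ℕ) x (fun i => L i.1) (fun i => N i.1)
      (γ.totalWeight + 1))
    {F : ι → ℕ → Γ} (hF0 : ∀ i, F i 0 = 1)
    (hF : ∀ i, ∀ k < m i, F i (k + 1) = γ.eval x ^ p (i, k) * e (i, k) * F i k) :
    ∃ e' ∈ boundedFamilies x L N' (γ.totalWeight + 1),
      ∀ i, F i (m i) = γ.eval x ^ (∑ t ∈ Finset.range (m i), p (i, t)) * e' i := by
  have hγ := totalWeight_pos γ
  obtain ⟨h, hh, F', hF'0, hF', -, hFF'⟩ := exists_pull_out γ hm hp hF0 hF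
  refine ⟨fun i => F' i (m i), ?_, hFF'⟩
  refine hP ι L N N' m _ hL hN hN' hm (by omega) le_rfl _ ?_ F' hF'0 hF'
  exact hC.conj_mem he hh (fun i => hL i.1) (fun i => hN i.1) (fun i => hN' i.1) (by omega)
    (by omega) (by omega)

lemma ProdBound.pred {n : ℕ} (hn : 1 ≤ n) (hP : ProdBound x (n + 1)) (hC : CommBound x (n + 1)) :
    ProdBound x n := by
  intro ι L N N' m w hL hN hN' hm hw hnw d hd
  rcases hnw.lt_or_eq with hlt | rfl
  · exact hP ι L N N' m w hL hN hN' hm hw hlt d hd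
  -- A factor of higher weight is carried along in the induction on `d`.
  suffices key : ∀ e ∈ boundedFamilies (ι := ι × ℕ) x (fun i => L i.1) (fun i => N i.1) (n + 1),
      ∀ F : ι → ℕ → Γ, (∀ i, F i 0 = 1) →
      (∀ i, ∀ k < m i, F i (k + 1) = (d * e) (i, k) * F i k) →
      (fun i => F i (m i)) ∈ boundedFamilies x L N' n by
    intro F hF0 hF
    exact key 1 (one_mem _) F hF0 (by simpa using hF)
  have step : ∀ (γ : FormalCommutator r) (p : ι × ℕ → ℤ), n ≤ γ.totalWeight →
      (∀ i, N i.1 * |p i| ≤ γ.length (L i.1)) →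
      ∀ d ∈ boundedFamilies (ι := ι × ℕ) x (fun i => L i.1) (fun i => N i.1) n,
      (∀ e ∈ boundedFamilies (ι := ι × ℕ) x (fun i => L i.1) (fun i => N i.1) (n + 1),
        ∀ F : ι → ℕ → Γ, (∀ i, F i 0 = 1) →
        (∀ i, ∀ k < m i, F i (k + 1) = (d * e) (i, k) * F i k) →
        (fun i => F i (m i)) ∈ boundedFamilies x L N' n) →
      (∀ e ∈ boundedFamilies (ι := ι × ℕ) x (fun i => L i.1) (fun i => N i.1) (n + 1),
        ∀ F : ι → ℕ → Γ, (∀ i, F i 0 = 1) →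
        (∀ i, ∀ k < m i, F i (k + 1) = γ.eval x ^ p (i, k) * (d * e) (i, k) * F i k) →
        (fun i => F i (m i)) ∈ boundedFamilies x L N' n) := by
    intro γ p hγ hp d hd ih e he F hF0 hF
    obtain ⟨h, hh, F', hF'0, hF', hS, hFF'⟩ := exists_pull_out γ hm hp hF0 hF
    have h1 : h⁻¹ * (d * e) * h = d * (comm d h * (h⁻¹ * e * h)) := by
      simp only [comm]; group
    have h2 := hC.conj_mem he hh (fun i => hL i.1) (fun i => hN i.1) (fun i => hN' i.1)
      (by omega) (by omega) (by omega)
    have h4 := hC.comm_mem (u := n + 1) hd hh (fun i => hL i.1) (fun i => hN i.1)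
      (fun i => hN' i.1) hn (hn.trans hγ) (by omega) (by omega)
    rw [h1] at hF'
    have h5 := ih _ (mul_mem h4 h2) F' hF'0 hF'
    have h6 := mul_mem (zpow_mem_boundedFamilies (x := x) hγ hS) h5
    convert h6 using 1
    funext i
    exact hFF' i
  induction hd using Subgroup.closure_induction_left with
  | one =>
    intro e he F hF0 hF
    exact boundedFamilies_mono (fun i => le_rfl) (Nat.le_succ n)
      (hP ι L N N' m _ hL hN hN' hm (by omega) le_rfl e he F hF0 (by simpa using hF))
  | mul_left a ha y hy ih =>
    obtain ⟨γ, p, h1, h2, rfl⟩ := ha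
    intro e he F hF0 hF
    refine step γ (fun i => p i) h1 (fun i => ?_) y hy ih e he F hF0 ?_
    · simpa using mod_cast h2 i
    · simpa [mul_assoc] using hF
  | inv_mul_cancel a ha y hy ih =>
    obtain ⟨γ, p, h1, h2, rfl⟩ := ha
    intro e he F hF0 hF
    refine step γ (fun i => - (p i : ℤ)) h1 (fun i => ?_) y hy ih e he F hF0 ?_
    · simpa using mod_cast h2 i
    · simpa [mul_assoc] using hF

/-- The commutator of powers `α ^ p` and `β ^ q` is `[α, β] ^ (p q)` up to a bounded factor of
higher weight. -/
lemma exists_comm_pow_eq (α β : FormalCommutator r) (hL : ∀ i j, 1 ≤ L i j)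
    (hN : ∀ i, 1 ≤ N i) (hN' : ∀ i, 1 ≤ N' i)
    (hC : CommBound x (α.totalWeight + β.totalWeight + 1))
    (hP : ProdBound x (α.totalWeight + β.totalWeight + 1)) {p q : ι → ℕ}
    (hp : ∀ i, N i * p i ≤ α.length (L i)) (hq : ∀ i, N' i * q i ≤ β.length (L i)) :
    ∃ e ∈ boundedFamilies x L (N * N') (α.totalWeight + β.totalWeight + 1), ∀ i,
      comm (α.eval x ^ p i) (β.eval x ^ q i) = (α.bracket β).eval x ^ (p i * q i) * e i := by
  set γ := α.bracket β with hγ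
  have hWγ : γ.totalWeight = α.totalWeight + β.totalWeight := totalWeight_bracket α β
  have hLγ : ∀ i, γ.length (L i) = α.length (L i) * β.length (L i) :=
    fun i => length_bracket (L i) α β
  have hα := totalWeight_pos α
  have hβ := totalWeight_pos β
  have hLα : ∀ i, 1 ≤ α.length (L i) := fun i => length_pos (hL i) α
  rw [← hWγ] at hC hP ⊢
  set a := α.eval x
  set b := β.eval x
  set c := γ.eval x
  have hc : c = comm a b := rfl
  -- First `[β ^ q, α]`, as the product of the conjugates of `[β, α]` by `β ^ k` for `k < q`.
  obtain ⟨e₁, he₁, H₁⟩ : ∃ e₁ ∈ boundedFamilies x L (fun i => α.length (L i) * N' i)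
      (γ.totalWeight + 1), ∀ i, comm (b ^ q i) a = c ^ (-(q i : ℤ)) * e₁ i := by
    have hb : (fun i : ι × ℕ => b ^ min i.2 (q i.1)) ∈
        boundedFamilies x (fun i : ι × ℕ => L i.1) (fun i => N' i.1) β.totalWeight :=
      pow_mem_boundedFamilies le_rfl fun i =>
        (Nat.mul_le_mul_left _ (min_le_right _ _)).trans (hq i.1)
    have hcm : (fun i : ι × ℕ => c ^ (-1 : ℤ)) ∈
        boundedFamilies x (fun i : ι × ℕ => L i.1) (fun i => γ.length (L i.1)) γ.totalWeight :=
      zpow_mem_boundedFamilies le_rfl fun i => by simp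
    have h2 := hC.comm_mem (u := γ.totalWeight + 1) hcm hb (fun i => hL i.1)
      (fun i => length_pos (hL i.1) γ) (fun i => hN' i.1) (by omega) hβ (by omega) (by omega)
    have hm : ∀ i, q i * (α.length (L i) * N' i) ≤ γ.length (L i) := fun i => by
      calc q i * (α.length (L i) * N' i) = α.length (L i) * (N' i * q i) := by ring
        _ ≤ _ := by rw [hLγ]; exact Nat.mul_le_mul_left _ (hq i)
    have hF : ∀ i, ∀ k < q i, comm (b ^ (k + 1)) a = c ^ (-1 : ℤ) *
        comm (fun _ => c ^ (-1 : ℤ)) (fun i : ι × ℕ => b ^ min i.2 (q i.1)) (i, k) *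
        comm (b ^ k) a := fun i k hk => by
      have : c ^ (-1 : ℤ) = comm b a := by rw [hc]; simp only [comm]; group
      rw [this]
      simp only [comm, Pi.mul_apply, Pi.inv_apply, min_eq_left hk.le, pow_succ']
      group
    obtain ⟨e', he', H⟩ := hP.main_term (N' := fun i => α.length (L i) * N' i) hC hL
      (fun i => length_pos (hL i) γ) (fun i => Nat.mul_pos (hLα i) (hN' i)) hm
      (p := fun _ => -1) (fun i => by simp) h2 (F := fun i k => comm (b ^ k) a)
      (fun i => by simp [comm]) hF
    refine ⟨e', he', fun i => ?_⟩
    rw [H]; simp [c]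
  have hcq : (fun i => c ^ (q i : ℤ)) ∈
      boundedFamilies x L (fun i => α.length (L i) * N' i) γ.totalWeight :=
    zpow_mem_boundedFamilies le_rfl fun i => by
      rw [hLγ]
      have := Nat.mul_le_mul_left (α.length (L i)) (hq i)
      rw [Nat.abs_cast]
      exact_mod_cast (by linarith)
  have hM : ∀ i, 1 ≤ α.length (L i) * N' i := fun i => Nat.mul_pos (hLα i) (hN' i)
  -- Hence `[α, β ^ q]`, by inversion.
  obtain ⟨e₂, he₂, H₂⟩ : ∃ e₂ ∈ boundedFamilies x L (fun i => α.length (L i) * N' i)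
      (γ.totalWeight + 1), ∀ i, comm a (b ^ q i) = c ^ (q i : ℤ) * e₂ i := by
    have h1 := hC.conj_mem (inv_mem he₁) hcq hL hM hM (by omega) (by omega) (by omega)
    refine ⟨_, h1, fun i => ?_⟩
    have : comm a (b ^ q i) = (comm (b ^ q i) a)⁻¹ := by simp only [comm]; group
    rw [this, H₁]
    simp [mul_assoc]
  -- Then `[α ^ p, β ^ q]`, as the product of the conjugates of `[α, β ^ q]` by `α ^ k`, `k < p`.
  have ha : (fun i : ι × ℕ => a ^ min i.2 (p i.1)) ∈
      boundedFamilies x (fun i : ι × ℕ => L i.1) (fun i => N i.1) α.totalWeight :=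
    pow_mem_boundedFamilies le_rfl fun i =>
      (Nat.mul_le_mul_left _ (min_le_right _ _)).trans (hp i.1)
  have hcq' := boundedFamilies_reindex (Prod.fst : ι × ℕ → ι) hcq
  have he₂' := boundedFamilies_reindex (Prod.fst : ι × ℕ → ι) he₂
  have h2 := hC.comm_mem (u := γ.totalWeight + 1) hcq' ha (fun i => hL i.1) (fun i => hM i.1)
    (fun i => hN i.1) (by omega) hα (by omega) (by omega)
  have h3 := hC.conj_mem he₂' ha (fun i => hL i.1) (fun i => hM i.1) (fun i => hN i.1) (by omega)
    (by omega) (by omega)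
  have hm : ∀ i, p i * (N * N') i ≤ α.length (L i) * N' i := fun i => by
    calc p i * (N * N') i = (N i * p i) * N' i := by simp only [Pi.mul_apply]; ring
      _ ≤ _ := Nat.mul_le_mul_right _ (hp i)
  have hq' : ∀ i : ι × ℕ, ((α.length (L i.1) * N' i.1 : ℕ) : ℤ) * |(q i.1 : ℤ)|
      ≤ γ.length (L i.1) := fun i => by
    rw [hLγ]
    have := Nat.mul_le_mul_left (α.length (L i.1)) (hq i.1)
    rw [Nat.abs_cast]
    exact_mod_cast (by linarith)
  have hF : ∀ i, ∀ k < p i, comm (a ^ (k + 1)) (b ^ q i) = c ^ (q i : ℤ) *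
      (comm (fun i : ι × ℕ => c ^ (q i.1 : ℤ)) (fun i : ι × ℕ => a ^ min i.2 (p i.1)) *
        ((fun i : ι × ℕ => a ^ min i.2 (p i.1))⁻¹ * (fun i : ι × ℕ => e₂ i.1) *
          (fun i : ι × ℕ => a ^ min i.2 (p i.1)))) (i, k) *
      comm (a ^ k) (b ^ q i) := fun i k hk => by
    have e1 : comm (a ^ (k + 1)) (b ^ q i)
        = (a ^ k)⁻¹ * comm a (b ^ q i) * a ^ k * comm (a ^ k) (b ^ q i) := by
      simp only [comm, pow_succ']; group
    rw [e1, H₂]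
    simp only [Pi.mul_apply, Pi.inv_apply, min_eq_left hk.le, comm]
    group
  obtain ⟨e', he', H⟩ := hP.main_term (N' := N * N') hC hL hM
    (fun i => Nat.mul_pos (hN i) (hN' i)) hm hq' (mul_mem h2 h3)
    (F := fun i k => comm (a ^ k) (b ^ q i)) (fun i => by simp [comm]) hF
  refine ⟨e', he', fun i => ?_⟩
  rw [H]
  simp only [Finset.sum_const, Finset.card_range, nsmul_eq_mul]
  rw [← zpow_natCast]
  push_cast
  rfl

/-- A subgroup containing all commutators of generators of `X` and `Y`, and normalized by `X` and
`Y`, contains all commutators of elements of `X` and `Y`. -/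
lemma comm_mem_of_closure {S T : Set Γ} {H : Subgroup Γ}
    (hS : ∀ h ∈ H, ∀ g ∈ Subgroup.closure S, g⁻¹ * h * g ∈ H)
    (hT : ∀ h ∈ H, ∀ g ∈ Subgroup.closure T, g⁻¹ * h * g ∈ H)
    (hST : ∀ s ∈ S, ∀ t ∈ T, comm s t ∈ H) {g h : Γ} (hg : g ∈ Subgroup.closure S)
    (hh : h ∈ Subgroup.closure T) : comm g h ∈ H := by
  have key : ∀ s ∈ S, comm s h ∈ H := by
    intro s hs
    induction hh using Subgroup.closure_induction with
    | mem t ht => exact hST s hs t ht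
    | one => simp [comm]
    | mul a b ha hb iha ihb =>
      have : comm s (a * b) = comm s b * (b⁻¹ * comm s a * b) := by simp only [comm]; group
      rw [this]
      exact mul_mem ihb (hT _ iha _ hb)
    | inv a ha iha =>
      have : comm s a⁻¹ = (a⁻¹)⁻¹ * (comm s a)⁻¹ * a⁻¹ := by simp only [comm]; group
      rw [this]
      exact hT _ (inv_mem iha) _ (inv_mem ha)
  induction hg using Subgroup.closure_induction with
  | mem s hs => exact key s hs
  | one => simp [comm]
  | mul a b ha hb iha ihb =>
    have : comm (a * b) h = (b⁻¹ * comm a h * b) * comm b h := by simp only [comm]; group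
    rw [this]
    exact mul_mem (hS _ iha _ hb) ihb
  | inv a ha iha =>
    have : comm a⁻¹ h = (a⁻¹)⁻¹ * (comm a h)⁻¹ * a⁻¹ := by simp only [comm]; group
    rw [this]
    exact hS _ (inv_mem iha) _ (inv_mem ha)

lemma CommBound.pred {n : ℕ} (hC : CommBound x (n + 1)) (hP : ProdBound x (n + 1)) :
    CommBound x n := by
  intro ι L N N' v w hL hN hN' hv hw hn g hg h hh
  have hNN : ∀ i, 1 ≤ (N * N') i := fun i => Nat.mul_pos (hN i) (hN' i)
  refine comm_mem_of_closure ?_ ?_ ?_ hg hh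
  · intro y hy z hz
    exact hC.conj_mem hy hz hL hNN hN (by omega) hv (by omega)
  · intro y hy z hz
    exact hC.conj_mem hy hz hL hNN hN' (by omega) hw (by omega)
  · rintro _ ⟨α, p, hα, hp, rfl⟩ _ ⟨β, q, hβ, hq, rfl⟩
    obtain ⟨e, he, H⟩ := exists_comm_pow_eq α β hL hN hN' (hC.mono (by omega))
      (hP.mono (by omega)) hp hq
    have h1 : (fun i => (α.bracket β).eval x ^ (p i * q i)) ∈
        boundedFamilies x L (N * N') (v + w) := by
      refine pow_mem_boundedFamilies (by rw [totalWeight_bracket]; omega) fun i => ?_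
      rw [length_bracket]
      calc (N * N') i * (p i * q i) = (N i * p i) * (N' i * q i) := by
            simp only [Pi.mul_apply]; ring
        _ ≤ _ := Nat.mul_le_mul (hp i) (hq i)
    have h2 := mul_mem h1 (boundedFamilies_mono (fun i => le_rfl) (by omega) he)
    convert h2 using 1
    funext i
    exact H i

/-- In a nilpotent group both bounds hold in all weights: beyond the nilpotency class everything is
trivial. -/
lemma commBound_and_prodBound {s : ℕ} (hx : ∀ α : FormalCommutator r, s < α.totalWeight →
    α.eval x = 1) : CommBound x 1 ∧ ProdBound x 1 := by
  have key : ∀ n, 1 ≤ n → n ≤ 2 * s + 2 → CommBound x n ∧ ProdBound x n := by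
    intro n hn hns
    induction hns using Nat.decreasingInduction with
    | self =>
      constructor
      · intro ι L N N' v w _ _ _ _ _ hvw g hg h hh
        rcases (by omega : s < v ∨ s < w) with hv | hw
        · rw [boundedFamilies_eq_bot hx hv, Subgroup.mem_bot] at hg
          simp [hg, comm]
        · rw [boundedFamilies_eq_bot hx hw, Subgroup.mem_bot] at hh
          simp [hh, comm]
      · intro ι L N N' m w _ _ _ _ _ hw d hd F hF0 hF
        rw [boundedFamilies_eq_bot hx (by omega), Subgroup.mem_bot] at hd
        subst hd
        have : ∀ i k, k ≤ m i → F i k = 1 := by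
          intro i k
          induction k with
          | zero => intro _; exact hF0 i
          | succ k ih => intro hk; rw [hF i k (by omega), ih (by omega)]; simp
        have h1 : (fun i => F i (m i)) = 1 := by funext i; exact this i _ le_rfl
        rw [h1]
        exact one_mem _
    | of_succ k hk ih =>
      obtain ⟨h1, h2⟩ := ih (by omega)
      exact ⟨h1.pred h2, h2.pred hn h1⟩
  exact key 1 le_rfl (by omega)

end NilpotentProgression

/-! ### Dense generating subsets of boxes in free abelian groups -/

namespace NilpotentProgression

variable {Γ : Type*} [Group Γ] {r : ℕ}

/-- Pigeonhole: among too many translates `A g^t` inside `Y`, two meet. -/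
lemma exists_div_mem_sq_of_card_lt {A Y : Set Γ} (hA : A⁻¹ = A) (hAf : A.Finite) (hY : Y.Finite)
    (T : Finset ℕ) (g : Γ) (hT : ∀ t ∈ T, ∀ a ∈ A, a * g ^ t ∈ Y)
    (hcard : Y.ncard < T.card * A.ncard) :
    ∃ t ∈ T, ∃ t' ∈ T, t ≠ t' ∧ g ^ t' * (g ^ t)⁻¹ ∈ A ^ 2 := by
  classical
  obtain ⟨A, rfl⟩ := hAf.exists_finset_coe
  obtain ⟨Y, rfl⟩ := hY.exists_finset_coe
  rw [Set.ncard_coe_finset, Set.ncard_coe_finset, ← Finset.card_product] at hcard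
  obtain ⟨⟨t, a⟩, h1, ⟨t', a'⟩, h2, hne, heq⟩ :=
    Finset.exists_ne_map_eq_of_card_lt_of_maps_to hcard
      (f := fun z : ℕ × Γ => z.2 * g ^ z.1) (fun z hz => by
        obtain ⟨h1, h2⟩ := Finset.mem_product.1 hz
        exact hT _ h1 _ h2)
  simp only [Finset.mem_product] at h1 h2
  refine ⟨t, h1.1, t', h2.1, fun h => ?_, ?_⟩
  · subst h
    exact absurd (by simpa using heq) (by simpa using hne)
  · rw [pow_two]
    refine ⟨a'⁻¹, by rw [← hA]; simpa using h2.2, a, h1.2, ?_⟩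
    have : a = a' * g ^ t' * (g ^ t)⁻¹ := by simp only at heq; rw [← heq]; group
    change a'⁻¹ * a = _
    rw [this]; group

/-- If `g ∈ A²` and the translates `A g^j` for `j ≤ J` lie in a set of fewer than `(n + 1) |A|`
elements, then every `g^j` with `j ≤ J` lies in a bounded power of `A`: walking along the powers
of `g`, each entry into a new power of `A` yields a translate of `A` disjoint from the previous
ones. -/
lemma pow_mem_pow_of_card_lt {A Y : Set Γ} (hA : A⁻¹ = A) (h1 : 1 ∈ A) (hAf : A.Finite)
    (hY : Y.Finite) {g : Γ} (hg : g ∈ A ^ 2) (J n : ℕ) (hJ : ∀ j ≤ J, ∀ a ∈ A, a * g ^ j ∈ Y)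
    (hcard : Y.ncard < (n + 1) * A.ncard) : ∀ j ≤ J, g ^ j ∈ A ^ (4 * n + 2) := by
  by_contra! hcon
  have step : ∀ k ≤ n, ∃ T : Finset ℕ, T.card = k + 1 ∧ (∀ t ∈ T, t ≤ J ∧ g ^ t ∈ A ^ (4 * k)) ∧
      ∀ t ∈ T, ∀ t' ∈ T, t ≠ t' → g ^ t' * (g ^ t)⁻¹ ∉ A ^ 2 := by
    intro k
    induction k with
    | zero =>
      intro _
      refine ⟨{0}, by simp, by simp, ?_⟩
      intro t ht t' ht' h
      simp only [Finset.mem_singleton] at ht ht'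
      omega
    | succ k ih =>
      intro hk
      obtain ⟨T, hT1, hT2, hT3⟩ := ih (by omega)
      have hex : ∃ j, j ≤ J ∧ g ^ j ∉ A ^ (4 * k + 2) := by
        obtain ⟨j, hj, hj'⟩ := hcon
        exact ⟨j, hj, fun h => hj' (Set.pow_subset_pow_right h1 (by omega) h)⟩
      classical
      obtain ⟨hj, hj'⟩ := Nat.find_spec hex
      set j := Nat.find hex with hjdef
      have hj0 : j ≠ 0 := by
        intro h0
        rw [h0] at hj'
        exact hj' (by simpa using Set.one_mem_pow h1)
      have hmin : g ^ (j - 1) ∈ A ^ (4 * k + 2) := by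
        by_contra hc
        have := Nat.find_min' hex ⟨by omega, hc⟩
        omega
      have hjpow : g ^ j ∈ A ^ (4 * (k + 1)) := by
        have h : g ^ j = g ^ (j - 1) * g := by rw [← pow_succ]; congr 1; omega
        rw [h, show 4 * (k + 1) = 4 * k + 2 + 2 by ring, pow_add]
        exact Set.mul_mem_mul hmin hg
      have hnew : ∀ t ∈ T, g ^ j * (g ^ t)⁻¹ ∉ A ^ 2 := by
        intro t ht h
        refine hj' ?_
        have h' : g ^ j = g ^ j * (g ^ t)⁻¹ * g ^ t := by group
        rw [h', add_comm, pow_add]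
        exact Set.mul_mem_mul h (hT2 t ht).2
      refine ⟨insert j T, ?_, ?_, ?_⟩
      · rw [Finset.card_insert_of_notMem, hT1]
        intro h
        exact hnew j h (by simpa using Set.one_mem_pow h1)
      · intro t ht
        rcases Finset.mem_insert.1 ht with rfl | ht
        · exact ⟨hj, hjpow⟩
        · exact ⟨(hT2 t ht).1, Set.pow_subset_pow_right h1 (by omega) (hT2 t ht).2⟩
      · intro t ht t' ht' hne h
        rcases Finset.mem_insert.1 ht with h2 | ht <;> rcases Finset.mem_insert.1 ht' with h3 | ht'
        · exact hne (h2.trans h3.symm)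
        · rw [h2] at h
          refine hnew t' ht' ?_
          rw [← hA, inv_pow, Set.mem_inv]
          simpa using h
        · rw [h3] at h
          exact hnew t ht h
        · exact hT3 t ht t' ht' hne h
  obtain ⟨T, hT1, hT2, hT3⟩ := step n le_rfl
  obtain ⟨t, ht, t', ht', hne, h⟩ := exists_div_mem_sq_of_card_lt hA hAf hY T g
    (fun t ht => hJ t (hT2 t ht).1) (by rw [hT1]; exact hcard)
  exact hT3 t ht t' ht' hne h

/-- Finitely many conditions that hold for some natural number hold for bounded numbers. -/
lemma exists_uniform_bound {σ : Type*} (S : Finset σ) (Pr : σ → ℕ → Prop) :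
    ∃ K, ∀ z ∈ S, (∃ k, Pr z k) → ∃ k ≤ K, Pr z k := by
  classical
  refine ⟨S.sup fun z => if h : ∃ k, Pr z k then Nat.find h else 0, fun z hz h => ?_⟩
  refine ⟨Nat.find h, ?_, Nat.find_spec h⟩
  have := Finset.le_sup (f := fun z => if h : ∃ k, Pr z k then Nat.find h else 0) hz
  simpa only [dif_pos h] using this

lemma exists_mem_pow_of_mem_closure {A : Set Γ} (hA : A⁻¹ = A) {g : Γ}
    (hg : g ∈ Subgroup.closure A) : ∃ k, g ∈ A ^ k := by
  induction hg using Subgroup.closure_induction with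
  | mem a ha => exact ⟨1, by simpa using ha⟩
  | one => exact ⟨0, by simp⟩
  | mul a b _ _ iha ihb =>
    obtain ⟨k, hk⟩ := iha
    obtain ⟨l, hl⟩ := ihb
    exact ⟨k + l, by rw [pow_add]; exact Set.mul_mem_mul hk hl⟩
  | inv a _ iha =>
    obtain ⟨k, hk⟩ := iha
    exact ⟨k, by rw [← hA, inv_pow, Set.mem_inv, inv_inv]; exact hk⟩

/-- The box `{v ∈ ℤʳ : |v j| ≤ L j}`, written multiplicatively. -/
def box (L : Fin r → ℕ) : Set (Multiplicative (Fin r → ℤ)) :=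
  {v | ∀ j, |v.toAdd j| ≤ L j}

lemma box_eq_coe (L : Fin r → ℕ) :
    box L = Multiplicative.toAdd ⁻¹' (Fintype.piFinset fun j => Finset.Icc (-(L j : ℤ)) (L j)) := by
  ext v
  simp [box, abs_le, Pi.le_def, forall_and]

lemma ncard_box (L : Fin r → ℕ) : (box L).ncard = ∏ j, (2 * L j + 1) := by
  rw [box_eq_coe, ← Equiv.image_symm_eq_preimage, Set.ncard_image_of_injective _
    (Equiv.injective _), Set.ncard_coe_finset, Fintype.card_piFinset]
  refine Finset.prod_congr rfl fun j _ => ?_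
  simp only [Int.card_Icc]
  omega

lemma finite_box (L : Fin r → ℕ) : (box L).Finite := by
  rw [box_eq_coe, ← Equiv.image_symm_eq_preimage]
  exact (Finset.finite_toSet _).image _

lemma ncard_box_smul_le (L : Fin r → ℕ) (n : ℕ) (hn : 1 ≤ n) :
    (box fun j => n * L j).ncard ≤ n ^ r * (box L).ncard := by
  rw [ncard_box, ncard_box]
  calc ∏ j, (2 * (n * L j) + 1) ≤ ∏ j : Fin r, n * (2 * L j + 1) :=
        Finset.prod_le_prod' fun j _ => by nlinarith
    _ = _ := by simp [Finset.prod_mul_distrib]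

lemma mul_mem_box {L L' : Fin r → ℕ} {v v' : Multiplicative (Fin r → ℤ)} (hv : v ∈ box L)
    (hv' : v' ∈ box L') : v * v' ∈ box (fun j => L j + L' j) := by
  intro j
  push_cast
  exact (abs_add_le _ _).trans (add_le_add (hv j) (hv' j))

/-- A dense symmetric set generating `ℤʳ` fills the box containing it in boundedly many steps. In
a direction `j` that is long compared to the inverse density, `A²` contains a bounded multiple
`q j` of the unit vector. Modulo these multiples only finitely many configurations remain, which
gives a uniform bound; the multiples of `q j` are then filled in by `pow_mem_pow_of_card_lt`. -/
theorem exists_box_subset_pow (r : ℕ) (c : ℝ) (hc : 0 < c) : ∃ K : ℕ, ∀ L : Fin r → ℕ,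
    ∀ A : Set (Multiplicative (Fin r → ℤ)), A ⊆ box L → A⁻¹ = A → 1 ∈ A →
      Subgroup.closure A = ⊤ → c * (box L).ncard ≤ A.ncard → box L ⊆ A ^ K := by
  classical
  -- directions of length less than `Q` are short
  set Q : ℕ := ⌊2 ^ r / c⌋₊ + 1 with hQ
  -- all residues occurring below lie in `D`; the configurations are the triples `(q, A, v)` of
  -- moduli and of reductions of `A` and `v` modulo `q`
  set D : Finset (Fin r → ℤ) := Fintype.piFinset fun _ => Finset.Icc (-(Q : ℤ)) Q
  obtain ⟨K₁, hK₁⟩ := exists_uniform_bound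
    ((Fintype.piFinset fun _ : Fin r => Finset.range (Q + 1)) ×ˢ D.powerset ×ˢ D)
    (fun z k => ∃ f : Fin k → Fin r → ℤ, (∀ t, f t ∈ z.2.1) ∧
      ∀ j, (z.1 j : ℤ) ∣ z.2.2 j - ∑ t, f t j)
  set n : ℕ := ⌊((K₁ + 2 : ℕ) : ℝ) ^ r / c⌋₊
  refine ⟨K₁ + r * (4 * n + 2), fun L A hAL hA h1 hgen hcard => ?_⟩
  have hAf : A.Finite := (finite_box L).subset hAL
  have hApos : 0 < A.ncard := (Set.ncard_pos hAf).2 ⟨1, h1⟩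
  -- cardinality comparison between `A` and dilated boxes
  have hcmp : ∀ k m : ℕ, 1 ≤ k → (k : ℝ) ^ r / c < m →
      (box fun j => k * L j).ncard < m * A.ncard := by
    intro k m hk hkm
    have e1 : ((box fun j => k * L j).ncard : ℝ) ≤ (k : ℝ) ^ r * (box L).ncard := by
      exact_mod_cast ncard_box_smul_le L k hk
    have e2 : (k : ℝ) ^ r * (box L).ncard ≤ (k : ℝ) ^ r / c * A.ncard := by
      rw [div_mul_eq_mul_div, le_div_iff₀ hc]
      nlinarith [pow_pos (show (0 : ℝ) < k by exact_mod_cast hk) r]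
    have e3 : (k : ℝ) ^ r / c * A.ncard < m * A.ncard := by gcongr
    exact_mod_cast (e1.trans e2).trans_lt e3
  -- the unit vectors
  let e : Fin r → Multiplicative (Fin r → ℤ) := fun j => Multiplicative.ofAdd (Pi.single j 1)
  have he : ∀ j (m : ℤ) i, (e j ^ m).toAdd i = if i = j then m else 0 := by
    intro j m i
    simp [e, Pi.single_apply]
  have hebox : ∀ j (m : ℕ) (k : ℕ), m ≤ k * L j → ∀ a ∈ A,
      a * e j ^ m ∈ box (fun i => (k + 1) * L i) := by
    intro j m k hm a ha i
    have h2 := mul_mem_box (L' := fun i => k * L i) (hAL ha) (v' := e j ^ m) (fun i => ?_) i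
    · refine h2.trans (le_of_eq ?_); push_cast; ring
    · rw [← zpow_natCast, he]
      split_ifs with h
      · subst h; simpa using mod_cast hm
      · simp only [abs_zero]; positivity
  have hq : ∀ j, ∃ q : ℕ, q ≤ Q ∧ (e j ^ q ∈ A ^ 2) ∧ (q = 0 → L j < Q) := by
    intro j
    by_cases hj : L j < Q
    · exact ⟨0, by omega, by simpa using Set.one_mem_pow h1, fun _ => hj⟩
    have hbig : (box fun i => 2 * L i).ncard < (Finset.range Q).card * A.ncard := by
      rw [Finset.card_range]
      refine hcmp 2 Q (by norm_num) ?_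
      rw [hQ]
      exact_mod_cast Nat.lt_floor_add_one _
    obtain ⟨t, ht, t', ht', hne, h⟩ := exists_div_mem_sq_of_card_lt hA hAf
      (finite_box fun i => 2 * L i) (Finset.range Q) (e j) (fun t ht a ha => hebox j t 1 (by
        have := Finset.mem_range.1 ht; omega) a ha) hbig
    have hmem : ∀ u u' : ℕ, u < u' → u' < Q → e j ^ u' * (e j ^ u)⁻¹ ∈ A ^ 2 →
        ∃ q : ℕ, q ≤ Q ∧ (e j ^ q ∈ A ^ 2) ∧ (q = 0 → L j < Q) := by
      intro u u' h1 h2 h3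
      refine ⟨u' - u, by omega, ?_, by omega⟩
      rwa [pow_sub _ h1.le]
    rcases hne.lt_or_gt with hlt | hlt
    · exact hmem t t' hlt (Finset.mem_range.1 ht') h
    · refine hmem t' t hlt (Finset.mem_range.1 ht) ?_
      rw [← hA, inv_pow, Set.mem_inv]
      simpa using h
  choose q hqQ hqA hq0 using hq
  -- filling in the multiples of `q j`
  have hfill : ∀ j (m : ℤ), |m * q j| ≤ (K₁ + 1 : ℕ) * L j →
      e j ^ (m * q j) ∈ A ^ (4 * n + 2) := by
    intro j m hm
    have hnat : ∀ m : ℕ, m * q j ≤ (K₁ + 1) * L j → e j ^ (m * q j) ∈ A ^ (4 * n + 2) := by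
      intro m hm
      rw [mul_comm m, pow_mul]
      refine pow_mem_pow_of_card_lt hA h1 hAf (finite_box fun i => (K₁ + 2) * L i) (hqA j) m n
        (fun t ht a ha => ?_) (hcmp (K₁ + 2) (n + 1) (by omega) ?_) m le_rfl
      · rw [← pow_mul]
        exact hebox j _ (K₁ + 1) (by nlinarith) a ha
      · exact (Nat.lt_floor_add_one _).trans_eq (Nat.cast_add_one n).symm
    have h3 := hnat m.natAbs (by
      rw [abs_mul, Int.abs_eq_natAbs, Nat.abs_cast] at hm
      exact_mod_cast hm)
    rcases Int.natAbs_eq m with h | h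
    · rw [h]; exact_mod_cast h3
    · rw [h, ← hA, inv_pow, Set.mem_inv, neg_mul, zpow_neg, inv_inv]; exact_mod_cast h3
  -- every vector is, modulo the `q j`, a sum of at most `K₁` elements of `A`
  intro v hv
  -- for `q j = 0`, reduction and divisibility modulo `q j` are the identity and equality with zero
  let ρ : Multiplicative (Fin r → ℤ) → Fin r → ℤ := fun v j => v.toAdd j % q j
  have hρ : ∀ v ∈ box L, ρ v ∈ D := by
    intro v hv
    refine Fintype.mem_piFinset.2 fun j => Finset.mem_Icc.2 ?_
    rcases Nat.eq_zero_or_pos (q j) with h0 | h0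
    · have := abs_le.1 (hv j)
      have := hq0 j h0
      simp only [ρ, h0, Nat.cast_zero, Int.emod_zero]
      omega
    · have := Int.emod_nonneg (v.toAdd j) (show (q j : ℤ) ≠ 0 by omega)
      have := Int.emod_lt_of_pos (v.toAdd j) (show (0 : ℤ) < q j by omega)
      have := hqQ j
      simp only [ρ]
      omega
  have hρdvd : ∀ v j, (q j : ℤ) ∣ v.toAdd j - ρ v j := fun v j => Int.dvd_self_sub_emod
  obtain ⟨A', hA'⟩ := hAf.exists_finset_coe
  obtain ⟨k, hk, f, hf, hfd⟩ := hK₁ (q, A'.image ρ, ρ v) (by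
      simp only [Finset.mem_product, Fintype.mem_piFinset, Finset.mem_range, Finset.mem_powerset]
      refine ⟨fun j => by have := hqQ j; omega, ?_, hρ v hv⟩
      intro z hz
      obtain ⟨a, ha, rfl⟩ := Finset.mem_image.1 hz
      exact hρ a (hAL (by rw [← hA']; exact ha))) (by
    obtain ⟨k, hk⟩ := exists_mem_pow_of_mem_closure hA
      (show v ∈ Subgroup.closure A by simp [hgen])
    obtain ⟨f, hf⟩ := Set.mem_pow.1 hk
    refine ⟨k, fun t => ρ (f t), fun t => Finset.mem_image_of_mem _ ?_, fun j => ?_⟩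
    · rw [← Finset.mem_coe, hA']; exact (f t).2
    · have h2 : v.toAdd j = ∑ t, (f t).1.toAdd j := by
        rw [← hf, List.prod_ofFn, toAdd_prod, Finset.sum_apply]
      have h3 : ρ v j - ∑ t, ρ (f t) j
          = ∑ t, ((f t).1.toAdd j - ρ (f t) j) - (v.toAdd j - ρ v j) := by
        rw [Finset.sum_sub_distrib, h2]; ring
      rw [h3]
      exact dvd_sub (Finset.dvd_sum fun t _ => hρdvd _ _) (hρdvd _ _))
  have hg : ∀ t, ∃ a ∈ A, ρ a = f t := fun t => by
    obtain ⟨a, ha, h⟩ := Finset.mem_image.1 (hf t)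
    exact ⟨a, by rw [← hA']; exact ha, h⟩
  choose g hgA hgf using hg
  have hdvd : ∀ j, (q j : ℤ) ∣ v.toAdd j - ∑ t, (g t).toAdd j := fun j => by
    have h3 : v.toAdd j - ∑ t, (g t).toAdd j
        = (v.toAdd j - ρ v j) - ∑ t, ((g t).toAdd j - ρ (g t) j) + (ρ v j - ∑ t, f t j) := by
      rw [Finset.sum_sub_distrib]; simp only [hgf]; ring
    rw [h3]
    exact dvd_add (dvd_sub (hρdvd _ _) (Finset.dvd_sum fun t _ => hρdvd _ _)) (hfd j)
  choose m hm using hdvd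
  have hv' : v = (∏ t, g t) * ∏ j, e j ^ (m j * q j) := by
    apply Multiplicative.toAdd.injective
    funext i
    rw [toAdd_mul, toAdd_prod, toAdd_prod, Pi.add_apply, Finset.sum_apply, Finset.sum_apply]
    simp only [he, Finset.sum_ite_eq, Finset.mem_univ, if_true]
    have := hm i
    linarith
  have hσ : ∏ t, g t ∈ A ^ K₁ := by
    refine Set.pow_subset_pow_right h1 hk ?_
    rw [← List.prod_ofFn]
    exact Set.mem_pow.2 ⟨fun t => ⟨g t, hgA t⟩, rfl⟩
  have hτ : ∏ j, e j ^ (m j * q j) ∈ A ^ (r * (4 * n + 2)) := by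
    rw [mul_comm, pow_mul, ← List.prod_ofFn]
    refine Set.mem_pow.2 ⟨fun j => ⟨e j ^ (m j * q j), hfill j (m j) ?_⟩, rfl⟩
    rw [mul_comm, ← hm j]
    have h2 : |∑ t, (g t).toAdd j| ≤ K₁ * L j := by
      refine (Finset.abs_sum_le_sum_abs _ _).trans ?_
      refine (Finset.sum_le_card_nsmul _ _ (L j : ℤ) fun t _ => hAL (hgA t) j).trans ?_
      rw [Finset.card_univ, Fintype.card_fin, nsmul_eq_mul]
      gcongr
    have h3 := abs_sub (v.toAdd j) (∑ t, (g t).toAdd j)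
    have h4 := hv j
    push_cast
    linarith
  rw [hv', pow_add]
  exact Set.mul_mem_mul hσ hτ

end NilpotentProgression

/-! ### From letters to formal commutators -/

namespace NilpotentProgression

variable {Γ : Type*} [Group Γ] {r : ℕ} {ι : Type}

lemma commutator_commutator_le_of_rotate {H₁ H₂ H₃ N : Subgroup Γ} [N.Normal]
    (h1 : ⁅⁅H₂, H₃⁆, H₁⁆ ≤ N) (h2 : ⁅⁅H₃, H₁⁆, H₂⁆ ≤ N) : ⁅⁅H₁, H₂⁆, H₃⁆ ≤ N := by
  have key : ∀ S : Subgroup Γ, S ≤ N ↔ S.map (QuotientGroup.mk' N) = ⊥ := fun S => by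
    rw [Subgroup.map_eq_bot_iff, QuotientGroup.ker_mk']
  rw [key, Subgroup.map_commutator, Subgroup.map_commutator] at h1 h2 ⊢
  exact Subgroup.commutator_commutator_eq_bot_of_rotate h1 h2

lemma commutator_lowerCentralSeries_le (m n : ℕ) :
    ⁅(⊤ : Subgroup Γ).lowerCentralSeries m, (⊤ : Subgroup Γ).lowerCentralSeries n⁆ ≤
      (⊤ : Subgroup Γ).lowerCentralSeries (m + n + 1) := by
  induction n generalizing m with
  | zero => exact le_rfl
  | succ n ih =>
    rw [Subgroup.commutator_comm, Subgroup.lowerCentralSeries_succ]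
    refine commutator_commutator_le_of_rotate ?_ ?_
    · rw [Subgroup.commutator_comm ⊤, ← Subgroup.lowerCentralSeries_succ]
      exact (ih (m + 1)).trans (le_of_eq (by congr 1; ring))
    · exact Subgroup.commutator_mono (ih m) le_rfl

lemma eval_mem_lowerCentralSeries (x : Fin r → Γ) (α : FormalCommutator r) :
    α.eval x ∈ (⊤ : Subgroup Γ).lowerCentralSeries (α.totalWeight - 1) := by
  induction α with
  | letter j => rw [totalWeight_letter]; trivial
  | bracket α β hα hβ =>
    have h1 := totalWeight_pos α
    have h2 := totalWeight_pos β
    have h3 := commutator_lowerCentralSeries_le _ _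
      (Subgroup.commutator_mem_commutator (inv_mem hα) (inv_mem hβ))
    rw [commutatorElement_def, inv_inv, inv_inv] at h3
    have h4 : (α.bracket β).totalWeight - 1 = α.totalWeight - 1 + (β.totalWeight - 1) + 1 := by
      rw [totalWeight_bracket]; omega
    rw [h4]
    exact h3

lemma eval_map {Γ' : Type*} [Group Γ'] (f : Γ →* Γ') (x : Fin r → Γ) (α : FormalCommutator r) :
    f (α.eval x) = α.eval (fun j => f (x j)) := by
  induction α with
  | letter j => rfl
  | bracket α β hα hβ => simp only [FormalCommutator.eval, map_mul, map_inv, hα, hβ]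

variable {x : Fin r → Γ} {L : ι → Fin r → ℕ}

/-- If `a ≡ α ^ p` and `b ≡ β ^ q` up to bounded factors of higher weight, then
`[a, b] ≡ [α, β] ^ (p q)` up to a bounded factor of higher weight. -/
lemma exists_comm_eq (hC : CommBound x 1) (hP : ProdBound x 1) (hL : ∀ i j, 1 ≤ L i j)
    {α β : FormalCommutator r} {p q : ι → ℕ} (hp : ∀ i, p i ≤ α.length (L i))
    (hq : ∀ i, q i ≤ β.length (L i)) {b b' : ι → Γ}
    (hb : b ∈ boundedFamilies x L 1 (α.totalWeight + 1))
    (hb' : b' ∈ boundedFamilies x L 1 (β.totalWeight + 1)) :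
    ∃ e ∈ boundedFamilies x L 1 (α.totalWeight + β.totalWeight + 1),
      comm ((fun i => α.eval x ^ p i) * b) ((fun i => β.eval x ^ q i) * b') =
        (fun i => (α.bracket β).eval x ^ (p i * q i)) * e := by
  have hα := totalWeight_pos α
  have hβ := totalWeight_pos β
  have h1 : ∀ i, 1 ≤ (1 : ι → ℕ) i := fun i => le_rfl
  have hg : (fun i => α.eval x ^ p i) ∈ boundedFamilies x L 1 α.totalWeight :=
    pow_mem_boundedFamilies le_rfl fun i => by simpa using hp i
  have hh : (fun i => β.eval x ^ q i) ∈ boundedFamilies x L 1 β.totalWeight :=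
    pow_mem_boundedFamilies le_rfl fun i => by simpa using hq i
  obtain ⟨e, he, H⟩ := exists_comm_pow_eq (N := 1) (N' := 1) α β hL h1 h1 (hC.mono (by omega))
    (hP.mono (by omega)) (fun i => by simpa using hp i) (fun i => by simpa using hq i)
  rw [one_mul] at he
  have hz : (fun i => (α.bracket β).eval x ^ (p i * q i)) ∈
      boundedFamilies x L 1 (α.totalWeight + β.totalWeight) := by
    refine pow_mem_boundedFamilies (by rw [totalWeight_bracket]) fun i => ?_
    rw [length_bracket]
    simpa using Nat.mul_le_mul (hp i) (hq i)
  set g : ι → Γ := fun i => α.eval x ^ p i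
  set h : ι → Γ := fun i => β.eval x ^ q i
  set z : ι → Γ := fun i => (α.bracket β).eval x ^ (p i * q i)
  have H' : comm g h = z * e := funext H
  have hhb : h * b' ∈ boundedFamilies x L 1 β.totalWeight :=
    mul_mem hh (boundedFamilies_mono h1 (Nat.le_succ _) hb')
  have e1 : comm (g * b) (h * b') = b⁻¹ * (comm g b' * (b'⁻¹ * comm g h * b')) * b *
      comm b (h * b') := by
    simp only [comm]; group
  have e2 : b⁻¹ * (comm g b' * (b'⁻¹ * comm g h * b')) * b * comm b (h * b') =
      z * ((z⁻¹ * (b⁻¹ * comm g b' * b) * z) * (comm z (b' * b) * ((b' * b)⁻¹ * e * (b' * b))) *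
        comm b (h * b')) := by
    rw [H']; simp only [comm]; group
  have hbb : b' * b ∈ boundedFamilies x L 1 1 :=
    mul_mem (boundedFamilies_mono h1 (by omega) hb') (boundedFamilies_mono h1 (by omega) hb)
  refine ⟨_, mul_mem (mul_mem ?_ (mul_mem ?_ ?_)) ?_, e1.trans e2⟩
  · refine hC.conj_mem (hC.conj_mem (hC.comm_mem hg hb' hL h1 h1 hα (by omega) (by omega)
      (by omega)) hb hL h1 h1 (by omega) (by omega) (by omega)) hz hL h1 h1 (by omega)
      (by omega) (by omega)
  · exact hC.comm_mem hz hbb hL h1 h1 (by omega) (by omega) (by omega) (by omega)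
  · exact hC.conj_mem he hbb hL h1 h1 (by omega) (by omega) (by omega)
  · exact hC.comm_mem hb hhb hL h1 h1 (by omega) (by omega) (by omega) (by omega)

/-- A subgroup containing, up to bounded factors of higher weight, all bounded powers of the
letters also contains, up to such factors, all bounded powers of formal commutators. -/
lemma exists_mem_eq_pow_mul (hC : CommBound x 1) (hP : ProdBound x 1) (hL : ∀ i j, 1 ≤ L i j)
    {H : Subgroup (ι → Γ)} (hH : ∀ j, ∀ p : ι → ℕ, (∀ i, p i ≤ L i j) →
      ∃ b ∈ boundedFamilies x L 1 2, (fun i => x j ^ p i) * b ∈ H) (α : FormalCommutator r) :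
    ∀ p : ι → ℕ, (∀ i, p i ≤ α.length (L i)) →
      ∃ b ∈ boundedFamilies x L 1 (α.totalWeight + 1), (fun i => α.eval x ^ p i) * b ∈ H := by
  have h1 : ∀ i, 1 ≤ (1 : ι → ℕ) i := fun i => le_rfl
  induction α with
  | letter j =>
    intro p hp
    rw [totalWeight_letter]
    exact hH j p (by simpa [length_letter] using hp)
  | bracket α β ihα ihβ =>
    intro p hp
    simp only [length_bracket] at hp
    rw [totalWeight_bracket]
    have hα := totalWeight_pos α
    have key : ∀ u v : ι → ℕ, (∀ i, u i ≤ α.length (L i)) → (∀ i, v i ≤ β.length (L i)) →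
        ∃ b ∈ boundedFamilies x L 1 (α.totalWeight + β.totalWeight + 1),
          (fun i => (α.bracket β).eval x ^ (u i * v i)) * b ∈ H := by
      intro u v hu hv
      obtain ⟨b, hb, h2⟩ := ihα u hu
      obtain ⟨b', hb', h3⟩ := ihβ v hv
      obtain ⟨e, he, h4⟩ := exists_comm_eq hC hP hL hu hv hb hb'
      refine ⟨e, he, ?_⟩
      rw [← h4]
      exact mul_mem (mul_mem (mul_mem (inv_mem h2) (inv_mem h3)) h2) h3
    -- division with remainder: `p = (p / L ^ χ(β)) L ^ χ(β) + p % L ^ χ(β)`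
    have hβpos : ∀ i, 1 ≤ β.length (L i) := fun i => length_pos (hL i) β
    obtain ⟨b, hb, h2⟩ := key (fun i => p i / β.length (L i)) (fun i => β.length (L i))
      (fun i => Nat.div_le_of_le_mul (by rw [mul_comm]; exact hp i)) (fun i => le_rfl)
    obtain ⟨b', hb', h3⟩ := key (fun i => 1) (fun i => p i % β.length (L i))
      (fun i => length_pos (hL i) α) (fun i => (Nat.mod_lt _ (hβpos i)).le)
    have hz : (fun i => (α.bracket β).eval x ^ (1 * (p i % β.length (L i)))) ∈
        boundedFamilies x L 1 (α.totalWeight + β.totalWeight) := by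
      refine pow_mem_boundedFamilies (by rw [totalWeight_bracket]) fun i => ?_
      rw [length_bracket]
      simpa using (Nat.mod_le (p i) (β.length (L i))).trans (hp i)
    have h4 := hC.conj_mem hb hz hL h1 h1 (by omega) (by omega) (by omega)
    refine ⟨_, mul_mem h4 hb', ?_⟩
    convert mul_mem h2 h3 using 1
    have hpow : (fun i => (α.bracket β).eval x ^ p i) =
        (fun i => (α.bracket β).eval x ^ (p i / β.length (L i) * β.length (L i))) *
        (fun i => (α.bracket β).eval x ^ (1 * (p i % β.length (L i)))) := by
      funext i
      rw [Pi.mul_apply, ← pow_add, one_mul, Nat.div_add_mod']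
    rw [hpow]
    group

/-- A subgroup containing, up to bounded factors of weight at least two, all bounded powers of the
letters contains all bounded families: the error terms are absorbed weight by weight. -/
lemma boundedFamilies_le {s : ℕ} (hx : ∀ α : FormalCommutator r, s < α.totalWeight →
    α.eval x = 1) (hL : ∀ i j, 1 ≤ L i j)
    {H : Subgroup (ι → Γ)} (hH : ∀ j, ∀ p : ι → ℕ, (∀ i, p i ≤ L i j) →
      ∃ b ∈ boundedFamilies x L 1 2, (fun i => x j ^ p i) * b ∈ H) :
    boundedFamilies x L 1 1 ≤ H := by
  obtain ⟨hC, hP⟩ := commBound_and_prodBound hx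
  refine Nat.decreasingInduction (n := s + 1)
    (motive := fun w _ => boundedFamilies x L 1 w ≤ H) ?_ ?_ (by omega : 1 ≤ s + 1)
  · intro w _ ih
    refine (Subgroup.closure_le _).2 ?_
    rintro _ ⟨α, p, hw, hp, rfl⟩
    obtain ⟨b, hb, h1⟩ := exists_mem_eq_pow_mul hC hP hL hH α p (by simpa using hp)
    have h2 := mul_mem h1 (inv_mem (ih (boundedFamilies_mono (fun i => le_rfl) (by omega) hb)))
    simpa using h2
  · rw [boundedFamilies_eq_bot hx (Nat.lt_succ_self s)]
    exact bot_le

end NilpotentProgression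

/-! ### Bounded families and the abelianization -/

namespace NilpotentProgression

variable {Γ : Type*} [Group Γ] {r : ℕ} {ι : Type} {x : Fin r → Γ} {L : ι → Fin r → ℕ}

lemma map_eval_eq_one {V : Type*} [CommGroup V] (π : Γ →* V) {α : FormalCommutator r}
    (hα : 2 ≤ α.totalWeight) : π (α.eval x) = 1 := by
  cases α with
  | letter j => rw [totalWeight_letter] at hα; omega
  | bracket α β => simp [FormalCommutator.eval]

lemma map_eq_one_of_mem_boundedFamilies {V : Type*} [CommGroup V] (π : Γ →* V) {N : ι → ℕ}
    {g : ι → Γ} (hg : g ∈ boundedFamilies x L N 2) (i : ι) : π (g i) = 1 := by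
  induction hg using Subgroup.closure_induction with
  | mem g hg =>
    obtain ⟨α, p, h1, -, rfl⟩ := hg
    simp [map_eval_eq_one π h1]
  | one => simp
  | mul a b _ _ ha hb => simp [ha, hb]
  | inv a _ ha => simp [ha]

/-- Bounded families modulo those of weight at least two form an abelian group generated by the
bounded powers of the letters. Hence a bounded family with trivial exponents in the letters has
weight at least two. -/
lemma mem_boundedFamilies_two_of_map_eq_one (hC : CommBound x 1) (hL : ∀ i j, 1 ≤ L i j)
    {π : Γ →* Multiplicative (Fin r → ℤ)}
    (hπ : ∀ j, π (x j) = Multiplicative.ofAdd (Pi.single j 1)) {g : ι → Γ}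
    (hg : g ∈ boundedFamilies x L 1 1) (hg1 : ∀ i, π (g i) = 1) :
    g ∈ boundedFamilies x L 1 2 := by
  have h1 : ∀ i, 1 ≤ (1 : ι → ℕ) i := fun i => le_rfl
  set B := boundedFamilies x L 1 1 with hB
  set N : Subgroup B := (boundedFamilies x L 1 2).subgroupOf B with hN
  have hcomm : ∀ a b : B, comm a b ∈ N := fun a b =>
    hC.comm_mem (u := 2) a.2 b.2 hL h1 h1 le_rfl le_rfl (by omega) le_rfl
  have hnormal : N.Normal := ⟨fun n hn g => by
    have := hC.conj_mem (x := x) (L := L) (N := 1) (N' := 1) (v := 2) (w := 1) hn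
      (inv_mem g.2) hL h1 h1 (by omega) le_rfl (by omega)
    rw [inv_inv] at this
    exact this⟩
  let _ : CommGroup (B ⧸ N) :=
    { (inferInstance : Group (B ⧸ N)) with
      mul_comm := by
        intro a b
        obtain ⟨a, rfl⟩ := QuotientGroup.mk_surjective a
        obtain ⟨b, rfl⟩ := QuotientGroup.mk_surjective b
        rw [← QuotientGroup.mk_mul, ← QuotientGroup.mk_mul, eq_comm, QuotientGroup.eq]
        convert hcomm a b using 1
        simp only [comm]; group }
  have hone : (fun _ => 1 : ι → Γ) ∈ B := one_mem B
  -- modulo `N`, a bounded family is a product of powers of the letters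
  have key : ∀ g (hg : g ∈ B), ∃ (m : Fin r → ι → ℤ) (hm : ∀ j, (fun i => x j ^ m j i) ∈ B),
      (QuotientGroup.mk ⟨g, hg⟩ : B ⧸ N) = ∏ j, QuotientGroup.mk ⟨_, hm j⟩ := by
    intro g hg
    induction hg using Subgroup.closure_induction with
    | mem g hg =>
      obtain ⟨α, p, hw, hp, rfl⟩ := hg
      have hgB : (fun i => α.eval x ^ p i) ∈ B := pow_mem_boundedFamilies hw hp
      cases α with
      | letter j =>
        refine ⟨Pi.single j fun i => p i, fun j' => ?_, ?_⟩
        · by_cases h : j' = j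
          · subst h; simpa [FormalCommutator.eval] using hgB
          · simpa [h] using hone
        · rw [Finset.prod_eq_single j]
          · congr 2; funext i; simp [FormalCommutator.eval]
          · intro j' _ hj'
            rw [← QuotientGroup.mk_one]
            congr 2; funext i; simp [hj']
          · simp
      | bracket α β =>
        refine ⟨0, fun j => by simpa using hone, ?_⟩
        have h2 : (⟨fun i => (α.bracket β).eval x ^ p i, hgB⟩ : B) ∈ N := by
          refine pow_mem_boundedFamilies (x := x) ?_ hp
          have := totalWeight_pos α
          have := totalWeight_pos β
          rw [totalWeight_bracket]; omega
        rw [(QuotientGroup.eq_one_iff _).2 h2, eq_comm]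
        refine Finset.prod_eq_one fun j _ => ?_
        rw [← QuotientGroup.mk_one]
        congr 2; funext i; simp
    | one =>
      refine ⟨0, fun j => by simpa using hone, ?_⟩
      change (1 : B ⧸ N) = _
      rw [eq_comm]
      refine Finset.prod_eq_one fun j _ => ?_
      rw [← QuotientGroup.mk_one]
      congr 2; funext i; simp
    | mul a b ha hb iha ihb =>
      obtain ⟨m, hm, e1⟩ := iha
      obtain ⟨m', hm', e2⟩ := ihb
      refine ⟨m + m', fun j => ?_, ?_⟩
      · convert mul_mem (hm j) (hm' j) using 1
        funext i; simp [zpow_add]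
      · rw [show (⟨a * b, mul_mem ha hb⟩ : B) = ⟨a, ha⟩ * ⟨b, hb⟩ from rfl, QuotientGroup.mk_mul,
          e1, e2, ← Finset.prod_mul_distrib]
        refine Finset.prod_congr rfl fun j _ => ?_
        rw [← QuotientGroup.mk_mul]
        congr 1
        apply Subtype.ext
        funext i; simp [zpow_add]
    | inv a ha iha =>
      obtain ⟨m, hm, e1⟩ := iha
      refine ⟨-m, fun j => ?_, ?_⟩
      · convert inv_mem (hm j) using 1
        funext i; simp
      · rw [show (⟨a⁻¹, inv_mem ha⟩ : B) = ⟨a, ha⟩⁻¹ from rfl, QuotientGroup.mk_inv,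
          e1, ← Finset.prod_inv_distrib]
        refine Finset.prod_congr rfl fun j _ => ?_
        rw [← QuotientGroup.mk_inv]
        congr 1
        apply Subtype.ext
        funext i; simp
  obtain ⟨m, hm, hgm⟩ := key g hg
  have hm0 : ∀ i j, m j i = 0 := by
    intro i j
    let φ : B ⧸ N →* Multiplicative (Fin r → ℤ) :=
      QuotientGroup.lift N ((π.comp (Pi.evalMonoidHom (fun _ => Γ) i)).comp B.subtype)
        fun n hn => map_eq_one_of_mem_boundedFamilies π hn i
    have h2 := congrArg φ hgm
    rw [map_prod] at h2
    have h3 : ∏ j, π (x j ^ m j i) = 1 := h2.symm.trans (hg1 i)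
    have h4 := congrFun (congrArg Multiplicative.toAdd h3) j
    simp only [map_zpow, hπ, toAdd_prod, toAdd_zpow, toAdd_ofAdd, toAdd_one] at h4
    simpa [Finset.sum_apply, Pi.single_apply] using h4
  have h5 : (QuotientGroup.mk ⟨g, hg⟩ : B ⧸ N) = 1 := by
    rw [hgm]
    refine Finset.prod_eq_one fun j _ => ?_
    rw [← QuotientGroup.mk_one]
    congr 2; funext i; simp [hm0]
  have h6 : (⟨g, hg⟩ : B) ∈ N := (QuotientGroup.eq_one_iff (⟨g, hg⟩ : B)).1 h5
  exact h6

end NilpotentProgression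

/-! ### Nilpotent progressions in a nilpotent group -/

namespace NilpotentProgression

variable {Γ : Type*} [Group Γ] {r : ℕ} {x : Fin r → Γ}

lemma mem_nilpotentProgression_cons {L : Fin r → ℕ} {α : FormalCommutator r}
    {l : List (FormalCommutator r)} {g : Γ} :
    g ∈ nilpotentProgression x L (α :: l) ↔
      ∃ e : ℤ, |e| ≤ α.length L ∧ ∃ h ∈ nilpotentProgression x L l, g = α.eval x ^ e * h := by
  have hprod : ∀ {k : ℕ} (f : Fin (k + 1) → Γ),
      (List.ofFn f).prod = f 0 * (List.ofFn fun i => f i.succ).prod := fun f => by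
    rw [List.ofFn_succ, List.prod_cons]
  constructor
  · rintro ⟨e, he, rfl⟩
    exact ⟨e 0, he 0, _, ⟨fun i => e i.succ, fun i => he i.succ, rfl⟩, hprod _⟩
  · rintro ⟨e, he, _, ⟨f, hf, rfl⟩, rfl⟩
    exact ⟨Fin.cons e f, Fin.cases he hf, (hprod fun i : Fin (l.length + 1) =>
      ((α :: l).get i).eval x ^ (Fin.cons e f : Fin (l.length + 1) → ℤ) i).symm⟩

lemma nilpotentProgression_nil (L : Fin r → ℕ) : nilpotentProgression x L [] = {1} := by
  ext g
  simp [nilpotentProgression, orderedProgression]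

lemma nilpotentProgression_append (L : Fin r → ℕ) (l l' : List (FormalCommutator r)) :
    nilpotentProgression x L (l ++ l') =
      nilpotentProgression x L l * nilpotentProgression x L l' := by
  induction l with
  | nil => simp [nilpotentProgression_nil]
  | cons α l ih =>
    ext g
    simp only [List.cons_append, mem_nilpotentProgression_cons, ih, Set.mem_mul]
    constructor
    · rintro ⟨e, he, _, ⟨a, ha, b, hb, rfl⟩, rfl⟩
      exact ⟨_, ⟨e, he, a, ha, rfl⟩, b, hb, by group⟩
    · rintro ⟨_, ⟨e, he, a, ha, rfl⟩, b, hb, rfl⟩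
      exact ⟨e, he, _, ⟨a, ha, b, hb, rfl⟩, by group⟩

lemma mem_nilpotentProgression_ofFn {k : ℕ} {f : Fin k → FormalCommutator r} {L : Fin r → ℕ}
    {g : Γ} : g ∈ nilpotentProgression x L (List.ofFn f) ↔
      ∃ t : Fin k → ℤ, (∀ j, |t j| ≤ (f j).length L) ∧
        g = (List.ofFn fun j => (f j).eval x ^ t j).prod := by
  induction k generalizing g with
  | zero => simp [nilpotentProgression_nil]
  | succ k ih =>
    rw [List.ofFn_succ, mem_nilpotentProgression_cons]
    simp only [ih]
    constructor
    · rintro ⟨e, he, _, ⟨t, ht, rfl⟩, rfl⟩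
      refine ⟨Fin.cons e t, fun i => ?_, by simp [List.ofFn_succ]⟩
      refine Fin.cases ?_ (fun i => ?_) i
      · exact he
      · exact ht i
    · rintro ⟨t, ht, rfl⟩
      exact ⟨t 0, ht 0, _, ⟨fun i => t i.succ, fun i => ht i.succ, rfl⟩, by simp [List.ofFn_succ]⟩

lemma finite_nilpotentProgression (L : Fin r → ℕ) (l : List (FormalCommutator r)) :
    (nilpotentProgression x L l).Finite := by
  induction l with
  | nil => simp [nilpotentProgression_nil]
  | cons α l ih =>
    refine ((Set.finite_Icc (-(α.length L : ℤ)) (α.length L)).image2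
      (fun e h => α.eval x ^ e * h) ih).subset ?_
    intro g hg
    obtain ⟨e, he, h, hh, rfl⟩ := mem_nilpotentProgression_cons.1 hg
    exact ⟨e, abs_le.1 he, h, hh, rfl⟩

lemma one_mem_nilpotentProgression (L : Fin r → ℕ) (l : List (FormalCommutator r)) :
    1 ∈ nilpotentProgression x L l :=
  ⟨0, by simp, by simp⟩

lemma eval_mem_nilpotentProgression {L : Fin r → ℕ} (hL : ∀ j, 1 ≤ L j)
    {l : List (FormalCommutator r)} {α : FormalCommutator r} (hα : α ∈ l) :
    α.eval x ∈ nilpotentProgression x L l := by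
  induction l with
  | nil => simp at hα
  | cons β l ih =>
    rw [mem_nilpotentProgression_cons]
    rcases List.mem_cons.1 hα with rfl | hα
    · exact ⟨1, by simpa using length_pos hL α, 1, one_mem_nilpotentProgression L l, by simp⟩
    · exact ⟨0, by simp, _, ih hα, by simp⟩

lemma map_nilpotentProgression {Γ' : Type*} [Group Γ'] (f : Γ →* Γ') (L : Fin r → ℕ)
    (l : List (FormalCommutator r)) :
    f '' nilpotentProgression x L l = nilpotentProgression (fun j => f (x j)) L l := by
  induction l with
  | nil => simp [nilpotentProgression_nil]
  | cons α l ih =>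
    ext g
    simp only [mem_nilpotentProgression_cons, ← ih, Set.mem_image]
    constructor
    · rintro ⟨_, ⟨e, he, h, hh, rfl⟩, rfl⟩
      exact ⟨e, he, _, ⟨h, hh, rfl⟩, by rw [map_mul, map_zpow, eval_map]⟩
    · rintro ⟨e, he, _, ⟨h, hh, rfl⟩, rfl⟩
      exact ⟨_, ⟨e, he, h, hh, rfl⟩, by rw [map_mul, map_zpow, eval_map]⟩

lemma mem_boundedFamilies_of_forall_mem {ι : Type} {L : ι → Fin r → ℕ}
    (l : List (FormalCommutator r)) {g : ι → Γ}
    (hg : ∀ i, g i ∈ nilpotentProgression x (L i) l) : g ∈ boundedFamilies x L 1 1 := by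
  induction l generalizing g with
  | nil =>
    have : g = 1 := funext fun i => by simpa [nilpotentProgression_nil] using hg i
    rw [this]
    exact one_mem _
  | cons α l ih =>
    choose e he h hh heq using fun i => mem_nilpotentProgression_cons.1 (hg i)
    have := mul_mem (zpow_mem_boundedFamilies (x := x) (N := 1) (totalWeight_pos α)
      (fun i => by simpa using he i)) (ih hh)
    convert this using 1
    exact funext heq

lemma mem_of_forall_mem_pow {ι : Type} {H : Subgroup (ι → Γ)} {S : ι → Set Γ}
    (hS : ∀ g : ι → Γ, (∀ i, g i ∈ S i) → g ∈ H) (k : ℕ) {g : ι → Γ}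
    (hg : ∀ i, g i ∈ S i ^ k) : g ∈ H := by
  induction k generalizing g with
  | zero =>
    have : g = 1 := funext fun i => by simpa using hg i
    rw [this]
    exact one_mem _
  | succ k ih =>
    have h1 : ∀ i, ∃ a ∈ S i ^ k, ∃ b ∈ S i, a * b = g i := fun i => by
      have := hg i
      rw [pow_succ] at this
      exact this
    choose a ha b hb hab using h1
    have := mul_mem (ih ha) (hS b hb)
    convert this using 1
    exact (funext hab).symm

variable {π : Γ →* Multiplicative (Fin r → ℤ)}

lemma map_prod_letters (hπ : ∀ j, π (x j) = Multiplicative.ofAdd (Pi.single j 1))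
    (t : Fin r → ℤ) :
    π (List.ofFn fun j => x j ^ t j).prod = Multiplicative.ofAdd t := by
  rw [map_list_prod, List.map_ofFn, List.prod_ofFn]
  apply Multiplicative.toAdd.injective
  funext i
  simp [hπ, toAdd_prod, Finset.sum_apply, Pi.single_apply]

lemma map_eq_one_of_mem_nilpotentProgression {L : Fin r → ℕ} {l : List (FormalCommutator r)}
    (hl : ∀ α ∈ l, 2 ≤ α.totalWeight) {g : Γ} (hg : g ∈ nilpotentProgression x L l) :
    π g = 1 := by
  induction l generalizing g with
  | nil => simp [nilpotentProgression_nil] at hg; simp [hg]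
  | cons α l ih =>
    obtain ⟨e, -, h, hh, rfl⟩ := mem_nilpotentProgression_cons.1 hg
    rw [map_mul, map_zpow, map_eval_eq_one π (hl α (by simp)),
      ih (fun β hβ => hl β (by simp [hβ])) hh]
    simp

/-- Normal form of the elements of the progression: exponents of the letters in a box, followed by
an element of the progression on the remaining commutators. -/
lemma nilpotentProgression_eq_image {L : Fin r → ℕ} (l : List (FormalCommutator r)) :
    nilpotentProgression x L (List.ofFn FormalCommutator.letter ++ l) =
      (fun z : Multiplicative (Fin r → ℤ) × Γ =>
        (List.ofFn fun j => x j ^ z.1.toAdd j).prod * z.2) ''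
        (box L ×ˢ nilpotentProgression x L l) := by
  rw [nilpotentProgression_append]
  ext g
  simp only [Set.mem_mul, mem_nilpotentProgression_ofFn, length_letter, Set.mem_image,
    Set.mem_prod, Prod.exists]
  constructor
  · rintro ⟨_, ⟨t, ht, rfl⟩, q, hq, rfl⟩
    exact ⟨Multiplicative.ofAdd t, q, ⟨ht, hq⟩, rfl⟩
  · rintro ⟨v, q, ⟨ht, hq⟩, rfl⟩
    exact ⟨_, ⟨v.toAdd, ht, rfl⟩, q, hq, rfl⟩

/-- All fibres of the progression over the box have the same size, hence a dense subset of the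
progression has a dense image in the box. -/
lemma ncard_box_le_ncard_image (hπ : ∀ j, π (x j) = Multiplicative.ofAdd (Pi.single j 1))
    {L : Fin r → ℕ} {l : List (FormalCommutator r)} (hl : ∀ α ∈ l, 2 ≤ α.totalWeight)
    {A : Set Γ} (hA : A ⊆ nilpotentProgression x L (List.ofFn FormalCommutator.letter ++ l))
    {c : ℝ} (hc : c * (nilpotentProgression x L
      (List.ofFn FormalCommutator.letter ++ l)).ncard ≤ A.ncard) :
    π '' A ⊆ box L ∧ c * (box L).ncard ≤ (π '' A).ncard := by
  set Q := nilpotentProgression x L l with hQ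
  have hQf : Q.Finite := finite_nilpotentProgression L l
  have hQpos : 0 < Q.ncard := (Set.ncard_pos hQf).2 ⟨1, one_mem_nilpotentProgression L l⟩
  set F : Multiplicative (Fin r → ℤ) × Γ → Γ :=
    fun z => (List.ofFn fun j => x j ^ z.1.toAdd j).prod * z.2 with hF
  have hπF : ∀ z, z.2 ∈ Q → π (F z) = z.1 := by
    intro z hz
    simp only [hF, map_mul, map_prod_letters hπ, map_eq_one_of_mem_nilpotentProgression hl hz,
      mul_one, ofAdd_toAdd]
  rw [nilpotentProgression_eq_image] at hA hc
  have hinj : Set.InjOn F (box L ×ˢ Q) := by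
    rintro ⟨v, q⟩ ⟨-, hq⟩ ⟨v', q'⟩ ⟨-, hq'⟩ h
    have h1 : v = v' := by
      have := congrArg π h
      rwa [hπF _ hq, hπF _ hq'] at this
    subst h1
    simpa [hF] using h
  rw [hinj.ncard_image, Set.ncard_prod] at hc
  have hsub : A ⊆ F '' ((π '' A) ×ˢ Q) := by
    intro a ha
    obtain ⟨z, ⟨h1, h2⟩, rfl⟩ := hA ha
    exact ⟨z, ⟨⟨_, ha, hπF z h2⟩, h2⟩, rfl⟩
  have hbox : π '' A ⊆ box L := by
    rintro _ ⟨a, ha, rfl⟩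
    obtain ⟨z, ⟨h1, h2⟩, rfl⟩ := hA ha
    rw [hπF z h2]
    exact h1
  have hfin : ((π '' A) ×ˢ Q).Finite := ((finite_box L).subset hbox).prod hQf
  have h3 : A.ncard ≤ (π '' A).ncard * Q.ncard := by
    rw [← Set.ncard_prod]
    exact (Set.ncard_le_ncard hsub (hfin.image _)).trans (Set.ncard_image_le hfin)
  refine ⟨hbox, le_of_mul_le_mul_right ?_ (show (0 : ℝ) < Q.ncard by exact_mod_cast hQpos)⟩
  have h4 : (A.ncard : ℝ) ≤ (π '' A).ncard * Q.ncard := by exact_mod_cast h3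
  push_cast at hc
  linarith

/-- The families `g` for which there is `k` with `g i ∈ A i ^ k` for all `i`. -/
def familiesInPow {ι : Type} (A : ι → Set Γ) (hA : ∀ i, (A i)⁻¹ = A i) :
    Subgroup (ι → Γ) where
  carrier := {g | ∃ k : ℕ, ∀ i, g i ∈ A i ^ k}
  one_mem' := ⟨0, fun i => by simp⟩
  mul_mem' := by
    rintro a b ⟨k, hk⟩ ⟨l, hl⟩
    exact ⟨k + l, fun i => by rw [pow_add]; exact Set.mul_mem_mul (hk i) (hl i)⟩
  inv_mem' := by
    rintro a ⟨k, hk⟩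
    exact ⟨k, fun i => by rw [← hA i, inv_pow, Set.mem_inv]; simpa using hk i⟩

/-- If the bound failed for all `K`, the counterexamples would form a family, indexed by `K`, for
which all elements of the progressions are bounded products of letters that lie in bounded powers
of `A` up to bounded families of weight at least two. -/
theorem exists_nilpotentProgression_subset_pow {s : ℕ} (hx : ∀ α : FormalCommutator r,
    s < α.totalWeight → α.eval x = 1)
    (hπ : ∀ j, π (x j) = Multiplicative.ofAdd (Pi.single j 1))
    {l : List (FormalCommutator r)} (hl : ∀ α ∈ l, 2 ≤ α.totalWeight) {c : ℝ} (hc : 0 < c) :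
    ∃ K : ℕ, ∀ (L : Fin r → ℕ) (A : Set Γ), (∀ j, 1 ≤ L j) →
      A ⊆ nilpotentProgression x L (List.ofFn FormalCommutator.letter ++ l) → A⁻¹ = A →
      1 ∈ A → (∀ j, x j ∈ Subgroup.closure A) →
      c * (nilpotentProgression x L (List.ofFn FormalCommutator.letter ++ l)).ncard ≤ A.ncard →
      nilpotentProgression x L (List.ofFn FormalCommutator.letter ++ l) ⊆ A ^ K := by
  obtain ⟨K₁, hK₁⟩ := exists_box_subset_pow r c hc
  by_contra! hcon
  choose L A hL hAP hA h1 hgen hcard hnot using hcon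
  choose g hgP hgA using fun K => Set.not_subset.1 (hnot K)
  obtain ⟨hC, -⟩ := commBound_and_prodBound hx
  have hle : boundedFamilies x L 1 1 ≤ familiesInPow A hA := by
    refine boundedFamilies_le hx hL fun j p hp => ?_
    have hbox : ∀ i, ∃ a ∈ A i ^ K₁, π a = Multiplicative.ofAdd (Pi.single j (p i : ℤ)) := by
      intro i
      obtain ⟨h2, h3⟩ := ncard_box_le_ncard_image hπ hl (hAP i) (hcard i)
      have h4 : Subgroup.closure (π '' A i) = ⊤ := by
        rw [← MonoidHom.map_closure, eq_top_iff]
        intro v _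
        refine ⟨(List.ofFn fun j => x j ^ v.toAdd j).prod, ?_, map_prod_letters hπ _⟩
        refine Subgroup.list_prod_mem _ fun y hy => ?_
        obtain ⟨j, rfl⟩ := List.mem_ofFn.1 hy
        exact zpow_mem (hgen i j) _
      have h5 := hK₁ (L i) (π '' A i) h2 (by rw [← Set.image_inv, hA]) ⟨1, h1 i, map_one π⟩ h4 h3
      rw [← Set.image_pow] at h5
      refine h5 (fun j' => ?_)
      by_cases h : j' = j
      · subst h; simpa using hp i
      · simp [h]
    choose a ha hπa using hbox
    have haB : a ∈ boundedFamilies x L 1 1 :=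
      mem_of_forall_mem_pow (S := A) (fun g hg =>
        mem_boundedFamilies_of_forall_mem _ fun i => hAP i (hg i)) K₁ ha
    have hpB : (fun i => x j ^ p i) ∈ boundedFamilies x L 1 1 :=
      pow_mem_boundedFamilies (α := FormalCommutator.letter j) (by rw [totalWeight_letter])
        fun i => by simpa [length_letter] using hp i
    refine ⟨(fun i => x j ^ p i)⁻¹ * a, mem_boundedFamilies_two_of_map_eq_one hC hL hπ
      (mul_mem (inv_mem hpB) haB) fun i => ?_, ?_⟩
    · rw [Pi.mul_apply, Pi.inv_apply, map_mul, map_inv, map_pow, hπ, hπa, inv_mul_eq_one,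
        ← ofAdd_nsmul, ← Pi.single_smul]
      simp
    · rw [mul_inv_cancel_left]
      exact ⟨K₁, ha⟩
  obtain ⟨k, hk⟩ := hle (mem_boundedFamilies_of_forall_mem _ hgP)
  exact hgA k (hk k)

end NilpotentProgression

/-! ### Free nilpotent progressions -/

namespace NilpotentProgression

variable {r : ℕ}

lemma isBasicList_eq_append {s : ℕ} {l : List (FormalCommutator r)} (hs : 1 ≤ s)
    (hl : IsBasicList r s l) :
    ∃ l', l = List.ofFn FormalCommutator.letter ++ l' ∧ ∀ α ∈ l', 2 ≤ α.totalWeight := by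
  induction hl with
  | zero => omega
  | one => exact ⟨[], by simp, by simp⟩
  | step hk _ _ mem_iff _ ih =>
    obtain ⟨l₀, rfl, h⟩ := ih hk
    refine ⟨l₀ ++ _, List.append_assoc _ _ _, fun α hα => ?_⟩
    rcases List.mem_append.1 hα with hα | hα
    · exact h α hα
    · rw [((mem_iff α).1 hα).1]; omega

lemma finite_setOf_isBasicList (r s : ℕ) : {l | IsBasicList r s l}.Finite := by
  classical
  induction s with
  | zero =>
    refine (Set.finite_singleton []).subset fun l hl => ?_
    cases hl
    rfl
  | succ s ih =>
    -- the brackets of entries of `l`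
    let T : List (FormalCommutator r) → Finset (FormalCommutator r) := fun l =>
      Finset.image₂ FormalCommutator.bracket l.toFinset l.toFinset
    refine ((Set.finite_singleton (List.ofFn FormalCommutator.letter)).union
      (ih.biUnion fun l _ => (T l).powerset.finite_toSet.biUnion fun S _ =>
        (List.finite_toSet S.toList.permutations).image (l ++ ·))).subset ?_
    intro l hl
    cases hl with
    | one => exact Or.inl rfl
    | @step k l l' hk hl nodup mem_iff _ =>
      refine Or.inr (Set.mem_biUnion hl (Set.mem_biUnion (x := l'.toFinset) ?_ ⟨l', ?_, rfl⟩))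
      · refine Finset.mem_coe.2 (Finset.mem_powerset.2 fun α hα => ?_)
        obtain ⟨i, j, -, rfl, -⟩ := ((mem_iff α).1 (List.mem_toFinset.1 hα)).2
        exact Finset.mem_image₂_of_mem (by simp) (by simp)
      · exact List.mem_permutations.2 (List.toFinset_toList nodup).symm

lemma insert_one_pow_subset {G : Type*} [Group G] (A : Set G) (K : ℕ) :
    insert 1 A ^ K ⊆ ⋃ k ∈ Set.Iic K, A ^ k := by
  induction K with
  | zero => simp
  | succ K ih =>
    rw [pow_succ]
    rintro _ ⟨a, ha, b, hb, rfl⟩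
    obtain ⟨k, hk, hak⟩ := Set.mem_iUnion₂.1 (ih ha)
    rw [Set.mem_Iic] at hk
    rcases hb with rfl | hb
    · exact Set.mem_iUnion₂.2 ⟨k, Set.mem_Iic.2 (by omega), by simpa using hak⟩
    · refine Set.mem_iUnion₂.2 ⟨k + 1, Set.mem_Iic.2 (by omega), ?_⟩
      rw [pow_succ]
      exact Set.mul_mem_mul hak hb

/-- The uniform bound in the free `s`-step nilpotent group, for all lists of basic commutators at
once; there are only finitely many. -/
theorem exists_subset_pow_of_isBasicList (r s : ℕ) (hs : 1 ≤ s) {c : ℝ} (hc : 0 < c) :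
    ∃ K : ℕ, ∀ l, IsBasicList r s l → ∀ (L : Fin r → ℕ)
      (A : Set (FreeGroup (Fin r) ⧸ (⊤ : Subgroup (FreeGroup (Fin r))).lowerCentralSeries s)),
      let x : Fin r → FreeGroup (Fin r) ⧸ (⊤ : Subgroup _).lowerCentralSeries s :=
        fun j => QuotientGroup.mk (FreeGroup.of j)
      (∀ j, 1 ≤ L j) → A ⊆ nilpotentProgression x L l → A⁻¹ = A →
      1 ∈ A → (∀ j, x j ∈ Subgroup.closure A) →
      c * (nilpotentProgression x L l).ncard ≤ A.ncard →
      nilpotentProgression x L l ⊆ A ^ K := by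
  set N := (⊤ : Subgroup (FreeGroup (Fin r))).lowerCentralSeries s
  set x : Fin r → FreeGroup (Fin r) ⧸ N := fun j => QuotientGroup.mk (FreeGroup.of j) with hxdef
  have hx : ∀ α : FormalCommutator r, s < α.totalWeight → α.eval x = 1 := by
    intro α hα
    have h1 := eval_map (QuotientGroup.mk' N) FreeGroup.of α
    refine h1.symm.trans ((QuotientGroup.eq_one_iff _).2 ?_)
    exact Subgroup.lowerCentralSeries_antitone _ (by omega) (eval_mem_lowerCentralSeries _ α)
  let π₀ : FreeGroup (Fin r) →* Multiplicative (Fin r → ℤ) :=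
    FreeGroup.lift fun j => Multiplicative.ofAdd (Pi.single j 1)
  have hN : N ≤ π₀.ker := by
    refine (Subgroup.lowerCentralSeries_antitone _ hs).trans ?_
    rw [Subgroup.top_lowerCentralSeries_one]
    exact Abelianization.commutator_subset_ker π₀
  have hπ : ∀ j, QuotientGroup.lift N π₀ hN (x j) = Multiplicative.ofAdd (Pi.single j 1) :=
    fun j => by simp [hxdef, π₀]
  obtain ⟨K, hK⟩ := exists_uniform_bound (finite_setOf_isBasicList r s).toFinset
    (fun l K => ∀ (L : Fin r → ℕ) (A : Set (FreeGroup (Fin r) ⧸ N)),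
      (∀ j, 1 ≤ L j) → A ⊆ nilpotentProgression x L l → A⁻¹ = A →
      1 ∈ A → (∀ j, x j ∈ Subgroup.closure A) →
      c * (nilpotentProgression x L l).ncard ≤ A.ncard →
      nilpotentProgression x L l ⊆ A ^ K)
  refine ⟨K, fun l hl L A hL hAP hA h1 hgen hcard => ?_⟩
  obtain ⟨k, hk, h⟩ := hK l (by simpa using hl) (by
    obtain ⟨l', rfl, hl'⟩ := isBasicList_eq_append hs hl
    exact exists_nilpotentProgression_subset_pow hx hπ hl' hc)
  exact (h L A hL hAP hA h1 hgen hcard).trans (Set.pow_subset_pow_right h1 hk)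

end NilpotentProgression

open NilpotentProgression in
theorem mainTheorem9 (r s : ℕ) :
    ∃ M : ℕ, ∀ c : ℝ, 0 < c → ∃ K : ℕ,
      ∀ (G : Type*) [Group G] (L : Fin r → ℕ) (P : Set G),
        IsFreeNilpotentProgression r s L P → (∀ i, M ≤ L i) →
        ∀ A : Set G, A ⊆ P → A⁻¹ = A → Subgroup.closure A = Subgroup.closure P →
          c * (P.ncard : ℝ) ≤ (A.ncard : ℝ) →
          P ⊆ ⋃ k ∈ Set.Iic K, A ^ k := by
  refine ⟨0, fun c hc => ?_⟩
  rcases Nat.eq_zero_or_pos s with rfl | hs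
  · -- in step zero the progression is trivial
    refine ⟨0, ?_⟩
    rintro G _ L P ⟨-, y, l, -, hl, rfl⟩ - A - - - -
    cases hl
    simp [nilpotentProgression_nil]
  obtain ⟨K, hK⟩ := exists_subset_pow_of_isBasicList r s hs hc
  refine ⟨K, ?_⟩
  rintro G _ L P ⟨hL, y, l, hfree, hl, rfl⟩ - A hAP hA hgen hcard
  specialize hK l hl L
  set N := (⊤ : Subgroup (FreeGroup (Fin r))).lowerCentralSeries s
  set x : Fin r → FreeGroup (Fin r) ⧸ N := fun j => QuotientGroup.mk (FreeGroup.of j) with hxdef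
  -- the isomorphism of the free nilpotent group onto the subgroup generated by the `y j`
  have hker : (FreeGroup.lift y).ker = N := hfree
  let ψ : FreeGroup (Fin r) ⧸ N →* G := QuotientGroup.lift N (FreeGroup.lift y) hker.ge
  have hψ : Function.Injective ψ := by
    rw [injective_iff_map_eq_one]
    intro a ha
    obtain ⟨a, rfl⟩ := QuotientGroup.mk_surjective a
    rw [QuotientGroup.eq_one_iff, ← hker]
    exact ha
  have hψx : (fun j => ψ (x j)) = y := funext fun j => by simp [ψ, hxdef]
  have hP : ψ '' nilpotentProgression x L l = nilpotentProgression y L l := by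
    rw [map_nilpotentProgression, hψx]
  rw [← hP] at hAP hgen hcard ⊢
  obtain ⟨A, hA', rfl⟩ := Set.subset_image_iff.1 hAP
  have hAinv : A⁻¹ = A := by
    rw [← Set.image_inv] at hA
    exact hψ.image_injective hA
  have hfin := finite_nilpotentProgression (x := x) L l
  rw [Set.ncard_image_of_injective _ hψ, Set.ncard_image_of_injective _ hψ] at hcard
  have hsub : insert 1 A ⊆ nilpotentProgression x L l :=
    Set.insert_subset (one_mem_nilpotentProgression L l) hA'
  have hxP : ∀ j, x j ∈ nilpotentProgression x L l := by
    intro j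
    obtain ⟨l', rfl, -⟩ := isBasicList_eq_append hs hl
    exact eval_mem_nilpotentProgression (α := FormalCommutator.letter j) hL (by simp)
  refine (Set.image_mono
    (hK (insert 1 A) hL hsub ?_ (Set.mem_insert _ _) (fun j => ?_) ?_)).trans ?_
  · rw [Set.inv_insert, inv_one, hAinv]
  · rw [← MonoidHom.map_closure, ← MonoidHom.map_closure] at hgen
    have h1 := Subgroup.map_injective hψ hgen
    refine Subgroup.closure_mono (Set.subset_insert 1 A) ?_
    rw [h1]
    exact Subgroup.subset_closure (hxP j)
  · refine hcard.trans ?_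
    exact_mod_cast Set.ncard_le_ncard (Set.subset_insert 1 A) (hfin.subset hsub)
  · rw [Set.image_pow, Set.image_insert_eq, map_one]
    exact insert_one_pow_subset _ K
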